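/- Let $k$ be a field, let $d \ge 3$ be an integer, and let $G$ be a finite simple graph on $[n]=\{1,\dots,n\}$. Let $$L_G(d)=\Big(\sum_{\ell=1}^{d} x_{i\ell}x_{j\ell} \;:\; \{i,j\}\in E(G)\Big)\subseteq S=k[x_{i\ell} : i\in[n],\ \ell\in[d]]$$ be the Lovász–Saks–Schrijver ideal of $G$. An ideal $I$ of a ring is called a complete intersection if its minimal number of generators $\mu(I)$ equals its height, and an almost complete intersection if $\mu(I)=\operatorname{ht}(I)+1$ and, for every minimal prime $\mathfrak p$ of $I$, the localization $I_{\mathfrak p}$ is a complete intersection. A graph is unicyclic if it contains precisely one cycle as a subgraph, and $\Delta(\cdot)$ denotes the maximal vertex degree. Assume that $G$ is connected, unicyclic, contains no $3$-cycle, and that $\Delta(G)>d$. Then $L_G(d)$ is an almost complete intersection if and only if $G$ has one of the following forms: 1. $G$ is obtained by adding a new edge between two distinct non-adjacent vertices of a tree $H$ with $V(H)=V(G)$ and $\Delta(H)\le d$; 2. $G$ is obtained from a tree $H$ and a unicyclic graph $U$ with $V(H)\cap V(U)=\emptyset$, $V(H)\cup V(U)=V(G)$, $\Delta(H)\le d$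 and $\Delta(U)\le d$, by adding one edge joining a vertex of $H$ to a vertex of $U$. -/

import Mathlib

namespace LSS

/-- An ideal `I` is a complete intersection if its minimal number of generators equals its height.
(Finite generation is recorded because `Submodule.spanFinrank` is `0` for ideals that are not
finitely generated.) -/
def IsCompleteIntersection {R : Type*} [CommRing R] (I : Ideal R) : Prop :=
  I.FG ∧ (Submodule.spanFinrank I : ℕ∞) = I.height

/-- An ideal `I` is an almost complete intersection if its minimal number of generators is one more
than its height and, for every minimal prime `p` of `I`, the localization `I_p` (an ideal of `R_p`)
is a complete intersection. -/
def IsAlmostCompleteIntersection {R : Type*} [CommRing R] (I : Ideal R) : Prop :=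
  I.FG ∧ (Submodule.spanFinrank I : ℕ∞) = I.height + 1 ∧
    ∀ (p : Ideal R) [p.IsPrime], p ∈ I.minimalPrimes →
      IsCompleteIntersection (I.map (algebraMap R (Localization.AtPrime p)))

/-- The polynomial `f_{ij} = ∑ l, x_{il} x_{jl}` in the variables `x_{il}`, `i ∈ V`, `l < d`. -/
noncomputable def lssPoly (k : Type*) [Field k] {V : Type*} (d : ℕ) (i j : V) :
    MvPolynomial (V × Fin d) k :=
  ∑ l : Fin d, MvPolynomial.X (i, l) * MvPolynomial.X (j, l)

/-- The Lovász-Saks-Schrijver ideal `L_G(d)` over the field `k`. -/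
noncomputable def lssIdeal (k : Type*) [Field k] {V : Type*} (G : SimpleGraph V) (d : ℕ) :
    Ideal (MvPolynomial (V × Fin d) k) :=
  Ideal.span {f | ∃ i j : V, G.Adj i j ∧ f = lssPoly k d i j}

/-- The maximal degree of a vertex of a finite graph (Mathlib's `SimpleGraph.maxDegree`, with the
finiteness and decidability instances supplied classically). -/
noncomputable def maxDeg {V : Type*} [Finite V] (G : SimpleGraph V) : ℕ :=
  letI := Fintype.ofFinite V
  letI := Classical.decRel G.Adj
  G.maxDegree

/-- A subgraph that is a cycle: it is isomorphic to the cycle graph `C_m` for some `m ≥ 3`. -/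
def IsCycleSubgraph {V : Type*} {G : SimpleGraph V} (C : G.Subgraph) : Prop :=
  ∃ m : ℕ, 3 ≤ m ∧ Nonempty (C.coe ≃g SimpleGraph.cycleGraph m)

/-- A graph is unicyclic if it contains precisely one cycle as a subgraph. -/
def IsUnicyclic {V : Type*} (G : SimpleGraph V) : Prop :=
  ∃! C : G.Subgraph, IsCycleSubgraph C

/-- `G` is obtained by adding one (new) edge between two vertices of a tree `H` with
`V(H) = V(G)` and `Δ(H) ≤ d`. -/
def IsTreePlusEdge {V : Type*} [Finite V] (G : SimpleGraph V) (d : ℕ) : Prop :=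
  ∃ (H : SimpleGraph V) (u v : V), H.IsTree ∧ maxDeg H ≤ d ∧ u ≠ v ∧ ¬ H.Adj u v ∧
    G = H ⊔ SimpleGraph.edge u v

/-- `G` is obtained from a tree `H` and a unicyclic graph `U` that are vertex-disjoint,
together cover `V(G)`, and satisfy `Δ(H) ≤ d` and `Δ(U) ≤ d`, by adding one edge between a vertex
of `H` and a vertex of `U`. -/
def IsTreeUnicyclicPlusEdge {V : Type*} [Finite V] (G : SimpleGraph V) (d : ℕ) : Prop :=
  ∃ (H U : G.Subgraph) (u v : V), H.coe.IsTree ∧ maxDeg H.coe ≤ d ∧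
    IsUnicyclic U.coe ∧ maxDeg U.coe ≤ d ∧
    Disjoint H.verts U.verts ∧ H.verts ∪ U.verts = Set.univ ∧
    u ∈ H.verts ∧ v ∈ U.verts ∧
    G = H.spanningCoe ⊔ U.spanningCoe ⊔ SimpleGraph.edge u v

end LSS

-- Both sides are equivalent to one degree condition: some edge `e` of `G` can be deleted so that
-- all degrees become at most `d`. If `e` lies on the cycle this is form 1; otherwise `e` is a
-- bridge and this is form 2.
--
-- The edge polynomials generate `L_G(d)` minimally, so `μ` is the number of edges. Setting the
-- vectors at a vertex set `T` to zero bounds the height by `d * |T|` plus the number of edges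
-- avoiding `T`. If the height is `μ - 1`, the choices `T = {a}` and `T = {a, b}` show that degrees
-- are at most `d + 1` and that vertices of degree above `d` are pairwise adjacent. As there are no
-- triangles, at most two such vertices exist, and one edge meets them all.
--
-- Conversely, a prime `P ⊇ L_G(d)` gives vectors over its residue field that are orthogonal along
-- edges. Adding them one by one in a tree order, a vector orthogonal to `r` independent earlier
-- ones raises the transcendence degree by at most `d - r`. With `T` the set of vertices with zero
-- vector, this gives height at least `d * |T|` plus the number of edges avoiding `T`
-- (`sum_priorRank_add_le`, `le_height_of_lssIdeal_le`). At most `d * |T|` edges other than `e` meet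
-- `T`, so the height is at least `μ - 1`. It is at least `μ` unless an end `c` of `e` has zero
-- vector and `d` other neighbours with independent vectors. In that exceptional case Cramer's rule
-- puts the variables of `c` into the localized ideal, so the generator of `e` is redundant there
-- and `μ - 1` generators suffice locally.

universe u

/-! ### Height and transcendence degree of primes in polynomial rings. -/

section Height

open Algebra

theorem Ideal.height_le_height_map_C {R : Type*} [CommRing R] [IsNoetherianRing R]
    (p : Ideal R) [hp : p.IsPrime] :
    p.height ≤ (p.map (Polynomial.C : R →+* Polynomial R)).height := by
  have hmp := Ideal.isPrime_map_C_of_isPrime (P := p)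
  have : (p.map (Polynomial.C : R →+* Polynomial R)).LiesOver p := by
    refine ⟨?_⟩
    ext x
    rw [Ideal.under_def, Ideal.mem_comap, Ideal.mem_map_C_iff, Polynomial.algebraMap_eq]
    refine ⟨fun h n => ?_, fun h => by simpa using h 0⟩
    rw [Polynomial.coeff_C]
    split_ifs <;> simp [h]
  rw [height_eq_height_add_of_liesOver_of_hasGoingDown p (p.map Polynomial.C)]
  exact le_self_add

theorem Ideal.trdeg_quotient_comap_le {k : Type*} {A B : Type u} [Field k] [CommRing A] [CommRing B]
    [Algebra k A] [Algebra k B] (f : A →ₐ[k] B) (P : Ideal B) :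
    Algebra.trdeg k (A ⧸ P.comap f) ≤ Algebra.trdeg k (B ⧸ P) :=
  trdeg_le_of_injective (Ideal.quotientMapₐ P f le_rfl)
    (Ideal.quotientMap_injective (f := f.toRingHom))

/-- Over `p = P ∩ R` there are two cases. If `P = p[X]`, the variable stays transcendental and the
transcendence degree gains one. Otherwise `P` strictly contains the prime `p[X]` and the height
gains one. -/
theorem Polynomial.le_height_add_trdeg {k : Type*} {R : Type*} [Field k] [CommRing R] [Algebra k R]
    [IsNoetherianRing R] (P : Ideal (Polynomial R)) [hP : P.IsPrime]
    (N : ℕ) (h : (N : ℕ∞) ≤ (P.comap Polynomial.C).height +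
      Cardinal.toENat (Algebra.trdeg k (R ⧸ P.comap Polynomial.C))) :
    ((N + 1 : ℕ) : ℕ∞) ≤ P.height + Cardinal.toENat (Algebra.trdeg k (Polynomial R ⧸ P)) := by
  set p := P.comap Polynomial.C with hp
  have hpp : p.IsPrime := Ideal.IsPrime.comap _
  have hle : p.map Polynomial.C ≤ P := Ideal.map_comap_le
  have hh := Ideal.height_le_height_map_C p
  have hmp := Ideal.isPrime_map_C_of_isPrime (P := p)
  push_cast
  rcases hle.eq_or_lt with heq | hlt
  · let g : Polynomial R →ₐ[k] Polynomial (R ⧸ p) := Polynomial.mapAlgHom (Ideal.Quotient.mkₐ k p)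
    have hg : ∀ a ∈ P, g a = 0 := by
      intro a ha
      rw [← heq, Ideal.mem_map_C_iff] at ha
      ext n
      simpa [g, Polynomial.coeff_map] using Ideal.Quotient.eq_zero_iff_mem.mpr (ha n)
    have hsurj : Function.Surjective (Ideal.Quotient.liftₐ P g hg) := by
      refine Ideal.Quotient.lift_surjective_of_surjective P hg ?_
      exact Polynomial.map_surjective _ Ideal.Quotient.mk_surjective
    have h1 := trdeg_le_of_surjective _ hsurj
    have h2 := trdeg_add_eq k (R ⧸ p) (A := Polynomial (R ⧸ p))
    rw [Polynomial.trdeg_of_isDomain] at h2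
    have h3 := OrderHomClass.mono Cardinal.toENat (h2.le.trans h1)
    simp only [map_add, map_one] at h3
    calc (N : ℕ∞) + 1 ≤ _ := add_le_add_left h 1
      _ ≤ _ := by
        rw [add_assoc]
        exact add_le_add (hh.trans (Ideal.height_mono hle)) (by simpa using h3)
  · have h1 := Ideal.height_add_one_le_of_lt_of_isPrime hlt
    have h2 : Algebra.trdeg k (R ⧸ p) ≤ Algebra.trdeg k (Polynomial R ⧸ P) :=
      Ideal.trdeg_quotient_comap_le (Polynomial.CAlgHom : R →ₐ[k] Polynomial R) P
    have h3 := OrderHomClass.mono Cardinal.toENat h2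
    calc (N : ℕ∞) + 1 ≤ _ := add_le_add_left h 1
      _ = _ := add_right_comm _ _ _
      _ ≤ _ := add_le_add ((add_le_add_left hh 1).trans h1) h3

theorem MvPolynomial.card_le_height_add_trdeg {k : Type*} [Field k] {ι : Type*} [Finite ι]
    (P : Ideal (MvPolynomial ι k)) (hP : P.IsPrime) :
    (Nat.card ι : ℕ∞) ≤
      P.height + Cardinal.toENat (Algebra.trdeg k (MvPolynomial ι k ⧸ P)) := by
  induction ι using Finite.induction_empty_option with
  | of_equiv e ih =>
    let E := MvPolynomial.renameEquiv k e
    have h1 := ih (P.comap E.toAlgHom) inferInstance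
    rw [Nat.card_congr e] at h1
    refine h1.trans (add_le_add (RingEquiv.height_comap E.toRingEquiv P).le ?_)
    refine OrderHomClass.mono Cardinal.toENat ?_
    exact Ideal.trdeg_quotient_comap_le E.toAlgHom P
  | h_empty => simp
  | @h_option ι _ ih =>
    let E := MvPolynomial.optionEquivLeft k ι
    let Q := P.comap E.symm.toAlgHom
    have h1 := Polynomial.le_height_add_trdeg (k := k) Q _ (ih (Q.comap Polynomial.C) inferInstance)
    rw [Nat.card_eq_fintype_card, ← Fintype.card_option, ← Nat.card_eq_fintype_card] at h1
    refine h1.trans (add_le_add (RingEquiv.height_comap E.symm.toRingEquiv P).le ?_)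
    refine OrderHomClass.mono Cardinal.toENat ?_
    exact Ideal.trdeg_quotient_comap_le E.symm.toAlgHom P

open IntermediateField in
/-- If all coordinates of the generic point of a prime ideal are rational functions of the elements
of a finite set `B`, then the codimension is at least the number of variables minus `#B`. -/
theorem MvPolynomial.card_le_height_add_card {k : Type*} [Field k] {ι : Type*} [Finite ι]
    (P : Ideal (MvPolynomial ι k)) [hP : P.IsPrime] (B : Finset P.ResidueField)
    (hB : ∀ i, algebraMap (MvPolynomial ι k) P.ResidueField (X i) ∈
      IntermediateField.adjoin k (B : Set P.ResidueField)) :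
    (Nat.card ι : ℕ∞) ≤ P.height + B.card := by
  refine (card_le_height_add_trdeg P hP).trans (add_le_add le_rfl ?_)
  set F := IntermediateField.adjoin k (B : Set P.ResidueField) with hF
  have hf : ∀ a, algebraMap (MvPolynomial ι k) P.ResidueField a ∈ F := by
    intro a
    induction a using MvPolynomial.induction_on with
    | C a =>
      rw [← MvPolynomial.algebraMap_eq, ← IsScalarTower.algebraMap_apply]
      exact F.algebraMap_mem a
    | add p q hp hq => rw [map_add]; exact F.add_mem hp hq
    | mul_X p i hp => rw [map_mul]; exact F.mul_mem hp (hB i)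
  have htop : ∀ a : P.ResidueField, a ∈ F := by
    intro a
    obtain ⟨x, y, -, rfl⟩ := IsFractionRing.div_surjective (A := MvPolynomial ι k ⧸ P) a
    obtain ⟨x, rfl⟩ := Ideal.Quotient.mk_surjective x
    obtain ⟨y, rfl⟩ := Ideal.Quotient.mk_surjective y
    exact F.div_mem (hf x) (hf y)
  have halg : Algebra.IsAlgebraic F P.ResidueField :=
    ⟨fun a => isAlgebraic_algebraMap (⟨a, htop a⟩ : F)⟩
  have halg' : Algebra.IsAlgebraic (Algebra.adjoin k (B : Set P.ResidueField)) P.ResidueField :=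
    IntermediateField.isAlgebraic_adjoin_iff_top.mp halg
  have h1 := trdeg_le_of_injective (IsScalarTower.toAlgHom k (MvPolynomial ι k ⧸ P) P.ResidueField)
    (IsFractionRing.injective _ _)
  have h2 := Algebra.IsAlgebraic.trdeg_le_cardinalMk k (B : Set P.ResidueField)
  have h3 := OrderHomClass.mono Cardinal.toENat (h1.trans h2)
  simpa using h3

end Height

/-! ### Transcendence degree of a sequence of vectors. -/

section Configuration

variable {k K V : Type*} [Field k] [Field K] [Algebra k K] {d : ℕ}

/-- The field generated by the coordinates of the vectors that come before `v`. -/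
noncomputable def priorField (k : Type*) [Field k] [Algebra k K] (σ : V → ℕ) (x : V → Fin d → K)
    (v : V) : IntermediateField k K :=
  IntermediateField.adjoin k {y | ∃ u l, σ u < σ v ∧ x u l = y}

/-- The dimension of the space of coordinates of `x v` over the field generated by the earlier
vectors; it bounds the growth of the transcendence degree. -/
noncomputable def priorRank (k : Type*) [Field k] [Algebra k K] (σ : V → ℕ) (x : V → Fin d → K)
    (v : V) : ℕ :=
  Module.finrank (priorField k σ x v) (Submodule.span (priorField k σ x v) (Set.range (x v)))

theorem mem_priorField {σ : V → ℕ} {x : V → Fin d → K} {u v : V} (h : σ u < σ v) (l : Fin d) :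
    x u l ∈ priorField k σ x v :=
  IntermediateField.subset_adjoin _ _ ⟨u, l, h, rfl⟩

/-- Adjoin the vectors in the order of `σ`: over the field of the earlier ones, the coordinates of
`x v` lie in the span of `priorRank` many elements, and it suffices to adjoin those. -/
theorem exists_finset_card_le_sum_priorRank [Fintype V] (σ : V → ℕ) (hσ : Function.Injective σ)
    (x : V → Fin d → K) :
    ∃ B : Finset K, B.card ≤ ∑ v, priorRank k σ x v ∧
      ∀ v l, x v l ∈ IntermediateField.adjoin k (B : Set K) := by
  classical
  have key : ∀ n : ℕ, ∃ B : Finset K, B.card ≤ ∑ v with σ v < n, priorRank k σ x v ∧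
      ∀ v l, σ v < n → x v l ∈ IntermediateField.adjoin k (B : Set K) := by
    intro n
    induction n with
    | zero => exact ⟨∅, by simp, by simp⟩
    | succ n ih =>
      obtain ⟨B, hB, hx⟩ := ih
      by_cases hn : ∃ v, σ v = n
      · obtain ⟨v, hv⟩ := hn
        set F := priorField k σ x v with hF
        have hfg : (Submodule.span F (Set.range (x v))).FG :=
          Submodule.fg_span (Set.finite_range _)
        obtain ⟨C, hC, hCs⟩ := hfg.exists_span_finset_card_eq_spanFinrank
        have hle : F ≤ IntermediateField.adjoin k ((B ∪ C : Finset K) : Set K) := by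
          refine IntermediateField.adjoin_le_iff.mpr ?_
          rintro _ ⟨u, l, hu, rfl⟩
          exact IntermediateField.adjoin.mono _ _ _ (by simp) (hx u l (hv ▸ hu))
        refine ⟨B ∪ C, ?_, ?_⟩
        · have h1 : ({u | σ u < n + 1} : Finset V) = insert v ({u | σ u < n} : Finset V) := by
            ext u
            simp only [Finset.mem_filter, Finset.mem_univ, true_and, Finset.mem_insert]
            constructor
            · intro h
              rcases Nat.lt_succ_iff_lt_or_eq.mp h with h | h
              · exact Or.inr h
              · exact Or.inl (hσ (h.trans hv.symm))
            · rintro (rfl | h) <;> omega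
          rw [h1, Finset.sum_insert (by simp [hv])]
          refine (Finset.card_union_le _ _).trans ?_
          have h2 : C.card = priorRank k σ x v := by
            rw [hC, priorRank, Module.finrank_eq_spanFinrank_of_free, Submodule.spanFinrank_top]
          omega
        · intro u l hu
          rcases Nat.lt_succ_iff_lt_or_eq.mp hu with h | h
          · exact IntermediateField.adjoin.mono _ _ _ (by simp) (hx u l h)
          · obtain rfl : u = v := hσ (h.trans hv.symm)
            have h1 : x u l ∈ Submodule.span F (C : Set K) := by
              rw [hCs]; exact Submodule.subset_span ⟨l, rfl⟩
            refine Submodule.span_induction (p := fun y _ =>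
              y ∈ IntermediateField.adjoin k ((B ∪ C : Finset K) : Set K)) ?_ ?_ ?_ ?_ h1
            · intro y hy
              exact IntermediateField.subset_adjoin _ _ (by simp [Finset.mem_coe.mp hy])
            · exact zero_mem _
            · intro y z _ _ hy hz; exact add_mem hy hz
            · intro a y _ hy
              rw [Algebra.smul_def]
              exact mul_mem (hle a.2) hy
      · refine ⟨B, ?_, fun v l hv => hx v l ?_⟩
        · refine hB.trans (Finset.sum_le_sum_of_subset ?_)
          exact Finset.monotone_filter_right _ fun v _ h => Nat.lt_succ_of_lt h
        · have : σ v ≠ n := fun h => hn ⟨v, h⟩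
          omega
  obtain ⟨n, hn⟩ : ∃ n, ∀ v, σ v < n :=
    ⟨Finset.univ.sup σ + 1, fun v => Nat.lt_succ_of_le (Finset.le_sup (Finset.mem_univ v))⟩
  obtain ⟨B, hB, hx⟩ := key n
  refine ⟨B, hB.trans (Finset.sum_le_sum_of_subset (Finset.filter_subset _ _)),
    fun v l => hx v l (hn v)⟩

/-- Every coordinate of `x` is an `F`-combination of the scalars `a i`, which need not lie in `F`.
-/
theorem finrank_span_range_le_card (F : IntermediateField k K) {ι : Type*} (s : Finset ι)
    (c : ι → Fin d → K) (hc : ∀ i ∈ s, ∀ l, c i l ∈ F) (a : ι → K) (x : Fin d → K)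
    (hx : x = ∑ i ∈ s, a i • c i) :
    Module.finrank F (Submodule.span F (Set.range x)) ≤ s.card := by
  classical
  have hle : Submodule.span F (Set.range x) ≤
      Submodule.span F ((s.image a : Finset K) : Set K) := by
    rw [Submodule.span_le]
    rintro _ ⟨l, rfl⟩
    rw [hx, Finset.sum_apply]
    refine Submodule.sum_mem _ fun i hi => ?_
    have : (a i • c i) l = (⟨c i l, hc i hi l⟩ : F) • a i := by
      rw [Pi.smul_apply, smul_eq_mul, mul_comm]; rfl
    rw [this]
    exact Submodule.smul_mem _ _ (Submodule.subset_span (by simpa using ⟨i, hi, rfl⟩))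
  exact (Submodule.finrank_mono hle).trans
    ((finrank_span_finset_le_card _).trans Finset.card_image_le)

/-- The vectors `c i` are independent elements of the kernel of the map from `F^d` to `K` given by
pairing with `x`; apply rank-nullity. -/
theorem finrank_span_range_add_card_le (F : IntermediateField k K) {r : ℕ}
    (c : Fin r → Fin d → K) (hc : ∀ i l, c i l ∈ F) (hli : LinearIndependent K c) (x : Fin d → K)
    (hx : ∀ i, c i ⬝ᵥ x = 0) :
    Module.finrank F (Submodule.span F (Set.range x)) + r ≤ d := by
  let c' : Fin r → Fin d → F := fun i l => ⟨c i l, hc i l⟩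
  have hli' : LinearIndependent F c' := by
    refine LinearIndependent.of_comp
      (LinearMap.compLeft (Algebra.linearMap F K) (Fin d)) ?_
    exact hli.restrict_scalars' F
  let φ := Fintype.linearCombination F x
  have h1 : LinearMap.range φ = Submodule.span F (Set.range x) :=
    Fintype.range_linearCombination F _
  have h2 := LinearMap.finrank_range_add_finrank_ker φ
  rw [h1, Module.finrank_fin_fun] at h2
  have h3 : r ≤ Module.finrank F (LinearMap.ker φ) := by
    have : LinearIndependent F (fun i => (⟨c' i, by
        rw [LinearMap.mem_ker, Fintype.linearCombination_apply, ← hx i]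
        rfl⟩ : LinearMap.ker φ)) :=
      LinearIndependent.of_comp (LinearMap.ker φ).subtype hli'
    simpa using this.fintype_card_le_finrank
  omega

end Configuration

/-! ### Counting parameters against edges. -/

section Counting

variable {k K V : Type*} [Field k] [Field K] [Algebra k K] {d : ℕ}

/-- The neighbours of `v` that come before `v` and whose vectors are nonzero. -/
def priorNeighbors (G : SimpleGraph V) (σ : V → ℕ) (x : V → Fin d → K) (v : V) : Set V :=
  {u | G.Adj u v ∧ σ u < σ v ∧ x u ≠ 0}

theorem priorRank_eq_zero (σ : V → ℕ) (x : V → Fin d → K) {v : V} (hv : x v = 0) :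
    priorRank k σ x v = 0 := by
  have h := finrank_span_range_le_card (priorField k σ x v) (∅ : Finset V) x (by simp) (fun _ => 0)
    (x v) (by simp [hv])
  simpa [priorRank] using h

theorem priorRank_le_one {σ : V → ℕ} {x : V → Fin d → K} {u v : V} (huv : σ u < σ v) (a : K)
    (h : x v = a • x u) : priorRank k σ x v ≤ 1 := by
  have h := finrank_span_range_le_card (priorField k σ x v) {u} x
    (fun i hi l => by rw [Finset.mem_singleton.mp hi]; exact mem_priorField huv l) (fun _ => a)
    (x v) (by simp [h])
  simpa [priorRank] using h

/-- The last vertex in the support of a linear relation has a vector that is a combination of at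
most `|W| - 1` earlier ones. -/
theorem exists_priorRank_lt_of_not_linearIndependent (σ : V → ℕ) (hσ : Function.Injective σ)
    (x : V → Fin d → K) (W : Finset V) (hW : W.card ≤ d)
    (hli : ¬ LinearIndependent K (fun w : W => x w)) :
    ∃ w ∈ W, priorRank k σ x w + 1 ≤ d := by
  classical
  rw [Fintype.not_linearIndependent_iff] at hli
  obtain ⟨g, hg, i, hi⟩ := hli
  let S : Finset W := {w | g w ≠ 0}
  obtain ⟨w, hw, hmax⟩ := S.exists_max_image (fun w => σ w) ⟨i, by simp [S, hi]⟩
  have hgw : g w ≠ 0 := by simpa [S] using hw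
  refine ⟨w, w.2, ?_⟩
  have hlt : ∀ u ∈ S.erase w, σ u < σ w := by
    intro u hu
    rw [Finset.mem_erase] at hu
    exact lt_of_le_of_ne (hmax u hu.2) fun h => hu.1 (Subtype.ext (hσ h))
  have h := finrank_span_range_le_card (priorField k σ x w) (S.erase w) (fun u : W => x u)
    (fun u hu l => mem_priorField (hlt u hu) l) (fun u => -((g w)⁻¹ * g u)) (x w) (by
      have h1 : ∑ u ∈ S, g u • x u = 0 := by
        rw [← hg]
        refine Finset.sum_subset (Finset.subset_univ _) fun u _ hu => ?_
        have : g u = 0 := by simpa [S] using hu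
        simp [this]
      rw [← Finset.add_sum_erase _ _ hw] at h1
      have h2 : x w = (g w)⁻¹ • (g w • x w) := by rw [smul_smul, inv_mul_cancel₀ hgw, one_smul]
      rw [h2, eq_neg_of_add_eq_zero_left h1, smul_neg, Finset.smul_sum, ← Finset.sum_neg_distrib]
      exact Finset.sum_congr rfl fun u _ => by rw [smul_smul, neg_smul])
  rw [Finset.card_erase_of_mem hw] at h
  have h3 : 0 < S.card := Finset.card_pos.mpr ⟨w, hw⟩
  have h4 : S.card ≤ W.card := by simpa using Finset.card_le_univ S
  change priorRank k σ x w ≤ _ at h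
  omega

theorem priorRank_add_card_le {G : SimpleGraph V} {σ : V → ℕ} {x : V → Fin d → K}
    (hx : ∀ u v, G.Adj u v → x u ⬝ᵥ x v = 0) (v : V) {r : ℕ} (u : Fin r → V)
    (hu : ∀ i, u i ∈ priorNeighbors G σ x v) (hli : LinearIndependent K (fun i => x (u i))) :
    priorRank k σ x v + r ≤ d :=
  finrank_span_range_add_card_le _ (fun i => x (u i)) (fun i l => mem_priorField (hu i).2.1 l) hli
    (x v) fun i => hx _ _ (hu i).1

theorem priorRank_add_ncard_le {G : SimpleGraph V} {σ : V → ℕ} {x : V → Fin d → K}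
    (hx : ∀ u v, G.Adj u v → x u ⬝ᵥ x v = 0) (v : V) (h : (priorNeighbors G σ x v).ncard ≤ 1) :
    priorRank k σ x v + (priorNeighbors G σ x v).ncard ≤ d := by
  rcases Nat.le_one_iff_eq_zero_or_eq_one.mp h with h | h
  · rw [h]
    exact priorRank_add_card_le hx v Fin.elim0 (fun i => i.elim0) linearIndependent_empty_type
  · rw [h]
    obtain ⟨u, hu⟩ := Set.ncard_eq_one.mp h
    have hu' : u ∈ priorNeighbors G σ x v := by rw [hu]; rfl
    exact priorRank_add_card_le hx v ![u] (by simpa using hu')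
      (LinearIndependent.of_subsingleton 0 hu'.2.2)

/-- Each such edge is counted at its later end. -/
theorem ncard_edges_le_sum_priorNeighbors [Fintype V] (G : SimpleGraph V) (σ : V → ℕ)
    (hσ : Function.Injective σ) (x : V → Fin d → K) [DecidablePred fun v => x v ≠ 0] :
    {e ∈ G.edgeSet | ∀ v ∈ e, x v ≠ 0}.ncard ≤
      ∑ v with x v ≠ 0, (priorNeighbors G σ x v).ncard := by
  classical
  let N : V → Finset V := fun v => (priorNeighbors G σ x v).toFinite.toFinset
  have hN : ∀ v, (priorNeighbors G σ x v).ncard = (N v).card := fun v =>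
    Set.ncard_eq_toFinset_card _ _
  simp_rw [hN]
  rw [← Finset.card_sigma, ← Set.ncard_coe_finset]
  refine (Set.ncard_le_ncard (t := (fun p : (_ : V) × V => s(p.1, p.2)) '' _) ?_
    (Set.toFinite _)).trans (Set.ncard_image_le (Set.toFinite _))
  rintro e ⟨he, hxe⟩
  induction e using Sym2.ind with
  | _ u v =>
    have huv : G.Adj u v := he
    have hu := hxe u (by simp)
    have hv := hxe v (by simp)
    rcases lt_or_gt_of_ne (fun h => huv.ne (hσ h)) with h | h
    · exact ⟨⟨v, u⟩, by simp [N, priorNeighbors, huv, hu, hv, h], Sym2.eq_swap⟩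
    · exact ⟨⟨u, v⟩, by simp [N, priorNeighbors, huv.symm, hu, hv, h], rfl⟩

/-- A nonzero vector with at most one prior neighbour satisfies rank plus number of prior neighbours
at most `d`. Only `z` can exceed this, by one, and the excess is recovered at a prior neighbour of
`z`. The term `ε` records a further unit saved at `w`. -/
theorem sum_priorRank_add_le [Fintype V] (hd : 3 ≤ d) (G : SimpleGraph V) (σ : V → ℕ)
    (hσ : Function.Injective σ) (x : V → Fin d → K) (hx : ∀ u v, G.Adj u v → x u ⬝ᵥ x v = 0)
    (z : V) (hz : (priorNeighbors G σ x z).ncard ≤ 2)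
    (hnz : ∀ v, v ≠ z → (priorNeighbors G σ x v).ncard ≤ 1)
    (ε : ℕ) (w : V) (hw : ε = 0 ∨ ε = 1 ∧ x w ≠ 0 ∧ (priorNeighbors G σ x w).ncard = 0 ∧
      priorRank k σ x w + 1 ≤ d) :
    ∑ v, priorRank k σ x v + d * {v | x v = 0}.ncard +
      {e ∈ G.edgeSet | ∀ v ∈ e, x v ≠ 0}.ncard + ε ≤ d * Fintype.card V := by
  classical
  have hE := ncard_edges_le_sum_priorNeighbors G σ hσ x
  set e : V → ℕ := fun v => (priorNeighbors G σ x v).ncard with he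
  set ρ : V → ℕ := priorRank k σ x with hρ
  have hgen : ∀ v, e v ≤ 1 → ρ v + e v ≤ d := fun v => priorRank_add_ncard_le hx v
  have hT : {v | x v = 0}.ncard + (Finset.univ.filter fun v => x v ≠ 0).card = Fintype.card V := by
    rw [Set.ncard_eq_toFinset_card', Set.toFinset_ofPred, Finset.card_filter_add_card_filter_not]
    rfl
  have hsum : ∑ v, ρ v = ∑ v with x v ≠ 0, ρ v :=
    (Finset.sum_subset (Finset.subset_univ _) fun v _ hv =>
      priorRank_eq_zero σ x (by simpa using hv)).symm
  suffices hmain : ∑ v with x v ≠ 0, ρ v + ∑ v with x v ≠ 0, e v + ε ≤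
      d * (Finset.univ.filter fun v => x v ≠ 0).card by
    rw [hsum, ← hT]
    nlinarith
  have hsingle : ∀ (y : V) (c : ℕ), (c = 0 ∨ x y ≠ 0) →
      ∑ v with x v ≠ 0, (if v = y then c else 0) = c := by
    intro y c hc
    rw [Finset.sum_ite_eq']
    rcases hc with hc | hc <;> simp [hc]
  have hwε : ε = 0 ∨ x w ≠ 0 := hw.imp_right fun h => h.2.1
  have hconst : d * (Finset.univ.filter fun v => x v ≠ 0).card = ∑ v with x v ≠ 0, d := by
    simp [mul_comm]
  by_cases hbad : x z ≠ 0 ∧ d < ρ z + e z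
  · obtain ⟨hxz, hbz⟩ := hbad
    have hez : e z = 2 := by
      by_contra h
      have := hgen z (by have : e z ≤ 2 := hz; omega)
      omega
    obtain ⟨u, y, huy, huy'⟩ := Set.ncard_eq_two.mp hez
    have key : ∀ u y : V, u ∈ priorNeighbors G σ x z → y ∈ priorNeighbors G σ x z → σ u < σ y →
        ∑ v with x v ≠ 0, ρ v + ∑ v with x v ≠ 0, e v + ε ≤
          d * (Finset.univ.filter fun v => x v ≠ 0).card := by
      intro u y hu hy hlt
      have hdep : ¬ LinearIndependent K ![x u, x y] := by
        intro hli
        have := priorRank_add_card_le (k := k) (G := G) (σ := σ) hx z ![u, y]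
          (by intro i; fin_cases i; exacts [hu, hy])
          (by convert hli using 1; ext i; fin_cases i <;> rfl)
        change ρ z + 2 ≤ d at this
        omega
      rw [LinearIndependent.pair_iff' hu.2.2] at hdep
      push Not at hdep
      obtain ⟨a, ha⟩ := hdep
      -- The later of the two dependent neighbours has rank at most one and at most one prior
      -- neighbour. Since `d ≥ 3`, this leaves the unit that pays for `z`; if `y = w`, there is no
      -- prior neighbour and the unit for `ε` fits as well.
      have hρy : ρ y ≤ 1 := priorRank_le_one hlt a ha.symm
      have hzy : y ≠ z := fun h => by have := hy.1.ne; exact this h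
      have hey : e y ≤ 1 := hnz y hzy
      have hρz : ρ z + 1 ≤ d :=
        priorRank_add_card_le hx z ![u] (by simpa using hu)
          (LinearIndependent.of_subsingleton 0 hu.2.2)
      have hpt : ∀ v, ρ v + e v + (if v = y then 1 else 0) + (if v = w then ε else 0) ≤
          d + (if v = z then 1 else 0) := by
        intro v
        by_cases hvz : v = z
        · subst hvz
          have : (if v = w then ε else 0) = 0 := by
            rcases hw with h | ⟨-, -, h, -⟩
            · simp [h]
            · rw [if_neg]; rintro rfl; change e v = 0 at h; omega
          rw [this, if_neg hzy.symm, if_pos rfl]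
          omega
        · rw [if_neg hvz]
          have hev : e v ≤ 1 := hnz v hvz
          have := hgen v hev
          rcases hw with h | ⟨h1, h2, h3, h4⟩
          · rw [h, ite_self]
            split_ifs with h5
            · subst h5; omega
            · omega
          · change e w = 0 at h3
            change ρ w + 1 ≤ d at h4
            split_ifs with h5 h6 h6
            · subst h5; subst h6; omega
            · subst h5; omega
            · subst h6; omega
            · omega
      have := Finset.sum_le_sum fun v (_ : v ∈ Finset.univ.filter fun v => x v ≠ 0) => hpt v
      simp only [Finset.sum_add_distrib] at this
      rw [hsingle y 1 (Or.inr hy.2.2), hsingle w ε hwε, hsingle z 1 (Or.inr hxz)] at this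
      rw [hconst]
      omega
    have hu : u ∈ priorNeighbors G σ x z := by rw [huy']; simp
    have hy : y ∈ priorNeighbors G σ x z := by rw [huy']; simp
    rcases lt_or_gt_of_ne (fun h => huy (hσ h)) with h | h
    · exact key u y hu hy h
    · exact key y u hy hu h
  · have hpt : ∀ v ∈ Finset.univ.filter fun v => x v ≠ 0,
        ρ v + e v + (if v = w then ε else 0) ≤ d := by
      intro v hv
      have h1 : ρ v + e v ≤ d := by
        by_cases hvz : v = z
        · subst hvz
          by_contra h
          exact hbad ⟨by simpa using hv, by omega⟩
        · exact hgen v (hnz v hvz)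
      split_ifs with h
      · subst h
        rcases hw with h | ⟨h2, -, h3, h4⟩
        · omega
        · change e v = 0 at h3
          change ρ v + 1 ≤ d at h4
          omega
      · omega
    have := Finset.sum_le_sum hpt
    simp only [Finset.sum_add_distrib] at this
    rw [hsingle w ε hwε] at this
    rw [hconst]
    omega

end Counting

/-! ### Unicyclic graphs, the two forms, and vertex orders. -/

section Graphs

open SimpleGraph

variable {V W : Type*} {G : SimpleGraph V}

theorem SimpleGraph.cycleGraph.mem_edges_cycle {n : ℕ} {u v : Fin (n + 3)}
    (h : (cycleGraph (n + 3)).Adj u v) : s(u, v) ∈ (cycleGraph.cycle n).edges := by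
  wlog huv : u - v = 1 generalizing u v
  · rw [Sym2.eq_swap]
    exact this h.symm ((cycleGraph_adj.mp h).resolve_left huv)
  rw [Walk.mk_mem_edges_iff_exists]
  have hu : u = v + 1 := by rw [← huv]; abel
  -- The walk `cycleGraph.cycle` runs downwards from `0`, so this is the position of `u`, and `v = u
  -- - 1` comes next.
  refine ⟨(n + 3 - u.val) % (n + 3), by simpa using Nat.mod_lt _ (by omega), ?_⟩
  have hlt : (n + 3 - u.val) % (n + 3) < n + 3 := Nat.mod_lt _ (by omega)
  rw [cycleGraph.getVert_cycle hlt.le, cycleGraph.getVert_cycle (by omega)]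
  have hu2 := u.2
  have hv2 := v.2
  have hval : u.val = (v.val + 1) % (n + 3) := by rw [hu, Fin.val_add]; rfl
  have h1 : (n + 3 - (n + 3 - u.val) % (n + 3)) % (n + 3) = u.val := by
    rcases Nat.eq_zero_or_pos u.val with h0 | h0
    · rw [h0]; simp
    · rw [Nat.mod_eq_of_lt (a := n + 3 - u.val) (by omega), Nat.mod_eq_of_lt (by omega)]; omega
  have h2 : (n + 3 - ((n + 3 - u.val) % (n + 3) + 1)) % (n + 3) = v.val := by
    rcases Nat.eq_zero_or_pos u.val with h0 | h0
    · have : v.val = n + 2 := by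
        by_contra hne
        rw [Nat.mod_eq_of_lt (by omega)] at hval
        omega
      rw [h0, this]
      simp
    · have : v.val + 1 < n + 3 := by
        by_contra hne
        have : v.val + 1 = n + 3 := by omega
        rw [this, Nat.mod_self] at hval
        omega
      rw [Nat.mod_eq_of_lt this] at hval
      rw [Nat.mod_eq_of_lt (a := n + 3 - u.val) (by omega), Nat.mod_eq_of_lt (by omega)]; omega
  have h3 : (⟨_, Nat.mod_lt _ (by omega)⟩ : Fin (n + 3)) = u := Fin.ext h1
  have h4 : (⟨_, Nat.mod_lt _ (by omega)⟩ : Fin (n + 3)) = v := Fin.ext h2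
  rw [h3, h4]

namespace LSS

theorem IsCycleSubgraph.exists_iso {C : G.Subgraph} (hC : IsCycleSubgraph C) :
    ∃ n, Nonempty (C.coe ≃g cycleGraph (n + 3)) := by
  obtain ⟨m, hm, h⟩ := hC
  obtain ⟨n, rfl⟩ := Nat.exists_eq_add_of_le' hm
  exact ⟨n, h⟩

theorem IsCycleSubgraph.not_isBridge {C : G.Subgraph} (hC : IsCycleSubgraph C) {a b : V}
    (hab : C.Adj a b) : ¬ G.IsBridge s(a, b) := by
  obtain ⟨n, ⟨φ⟩⟩ := hC.exists_iso
  intro hb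
  let f : cycleGraph (n + 3) →g G := C.hom.comp φ.symm.toHom
  have hf : Function.Injective f := Subgraph.hom_injective.comp φ.symm.injective
  refine hb.notMem_edges_of_isCycle
    ((Walk.isCycle_map_iff_of_injective hf).mpr (cycleGraph.isCycle_cycle (n := n))) ?_
  rw [Walk.edges_map, List.mem_map]
  have h1 : (cycleGraph (n + 3)).Adj (φ ⟨a, C.edge_vert hab⟩) (φ ⟨b, C.edge_vert hab.symm⟩) :=
    φ.map_adj_iff.mpr hab
  refine ⟨_, cycleGraph.mem_edges_cycle h1, ?_⟩
  simp [f]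

theorem IsCycleSubgraph.preconnected {C : G.Subgraph} (hC : IsCycleSubgraph C) :
    C.coe.Preconnected := by
  obtain ⟨n, ⟨φ⟩⟩ := hC.exists_iso
  exact φ.preconnected_iff.mpr cycleGraph_preconnected

theorem IsCycleSubgraph.exists_adj_ne {C : G.Subgraph} (hC : IsCycleSubgraph C) (c : V) :
    ∃ a b, C.Adj a b ∧ c ≠ a ∧ c ≠ b := by
  classical
  obtain ⟨n, ⟨φ⟩⟩ := hC.exists_iso
  obtain ⟨i, hi⟩ : ∃ i, ∀ j, ((φ.symm j : C.verts) : V) = c → j = i := by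
    by_cases h : ∃ i, ((φ.symm i : C.verts) : V) = c
    · obtain ⟨i, hi⟩ := h
      exact ⟨i, fun j hj => φ.symm.injective (Subtype.ext (hj.trans hi.symm))⟩
    · exact ⟨0, fun j hj => (h ⟨j, hj⟩).elim⟩
  -- Only position `i` can be `c`; since the length is at least `3`, the next two positions avoid
  -- it.
  refine ⟨φ.symm (i + 1), φ.symm (i + 1 + 1), ?_, fun h => ?_, fun h => ?_⟩
  · have : (cycleGraph (n + 3)).Adj (i + 1) (i + 1 + 1) := by
      rw [cycleGraph_adj]; right; abel
    exact φ.symm.map_adj_iff.mpr this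
  · have := hi _ h.symm
    simp at this
  · have := hi _ h.symm
    rw [add_assoc, add_eq_left] at this
    have := congrArg Fin.val this
    rw [Fin.val_add] at this
    have h1 : ((1 : Fin (n + 3)) : ℕ) = 1 := rfl
    rw [h1, Nat.mod_eq_of_lt (by omega)] at this
    simp at this

theorem IsCycleSubgraph.map {G' : SimpleGraph W} (f : Copy G G') {C : G.Subgraph}
    (hC : IsCycleSubgraph C) : IsCycleSubgraph (C.map f.toHom) := by
  obtain ⟨m, hm, ⟨φ⟩⟩ := hC
  exact ⟨m, hm, ⟨(f.isoSubgraphMap C).symm.trans φ⟩⟩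

theorem exists_isCycleSubgraph_of_not_isAcyclic (h : ¬ G.IsAcyclic) :
    ∃ C : G.Subgraph, IsCycleSubgraph C := by
  rw [isAcyclic_iff_free_cycleGraph] at h
  push Not at h
  obtain ⟨m, hm, hf⟩ := h
  obtain ⟨f⟩ := hf
  exact ⟨f.toSubgraph, m, hm, ⟨f.isoToSubgraph.symm⟩⟩

theorem isAcyclic_of_le_of_not_adj {G' : SimpleGraph V} (hle : G' ≤ G) {C : G.Subgraph}
    (huniq : ∀ C', IsCycleSubgraph C' → C' = C) {a b : V} (hab : C.Adj a b)
    (h : ¬ G'.Adj a b) : G'.IsAcyclic := by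
  by_contra hcon
  obtain ⟨C', hC'⟩ := exists_isCycleSubgraph_of_not_isAcyclic hcon
  have h1 := huniq _ (hC'.map (Copy.ofLE _ _ hle))
  rw [← h1] at hab
  obtain ⟨u, v, huv, rfl, rfl⟩ := hab
  exact h huv.adj_sub

theorem isTree_deleteEdges (hconn : G.Connected) {C : G.Subgraph} (hC : IsCycleSubgraph C)
    (huniq : ∀ C', IsCycleSubgraph C' → C' = C) {a b : V} (hab : C.Adj a b) :
    (G.deleteEdges {s(a, b)}).IsTree :=
  ⟨hconn.connected_delete_edge_of_not_isBridge (hC.not_isBridge hab),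
    isAcyclic_of_le_of_not_adj (deleteEdges_le _) huniq hab (by simp)⟩

theorem ncard_edgeSet_deleteEdges [Finite V] {e : Sym2 V} (he : e ∈ G.edgeSet) :
    (G.deleteEdges {e}).edgeSet.ncard + 1 = G.edgeSet.ncard := by
  rw [edgeSet_deleteEdges]
  exact Set.ncard_sdiff_singleton_add_one he (Set.toFinite _)

theorem IsUnicyclic.ncard_edgeSet [Finite V] (hconn : G.Connected) (h : IsUnicyclic G) :
    G.edgeSet.ncard = Nat.card V := by
  obtain ⟨C, hC, huniq⟩ := h
  obtain ⟨c⟩ := hconn.nonempty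
  obtain ⟨a, b, hab, -⟩ := hC.exists_adj_ne c
  have h1 := (isTree_iff_connected_and_card.mp (isTree_deleteEdges hconn hC huniq hab)).2
  rw [← h1, ← ncard_edgeSet_deleteEdges (G.mem_edgeSet.mpr hab.adj_sub)]
  rfl

/-- Otherwise deleting the edge leaves a connected graph with `|V| - 1` edges, that is, a tree,
which still contains `C`. -/
theorem isBridge_of_not_mem_cycle [Finite V] (hconn : G.Connected) {C : G.Subgraph}
    (hC : IsCycleSubgraph C) (huniq : ∀ C', IsCycleSubgraph C' → C' = C) {a b : V}
    (hG : G.Adj a b) (hab : ¬ C.Adj a b) : G.IsBridge s(a, b) := by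
  by_contra hcon
  have h1 := hconn.connected_delete_edge_of_not_isBridge hcon
  have h2 : (G.deleteEdges {s(a, b)}).IsTree := by
    rw [isTree_iff_connected_and_card]
    refine ⟨h1, ?_⟩
    rw [← IsUnicyclic.ncard_edgeSet hconn ⟨C, hC, huniq⟩,
      ← ncard_edgeSet_deleteEdges (G.mem_edgeSet.mpr hG)]
    rfl
  obtain ⟨n, ⟨φ⟩⟩ := hC.exists_iso
  refine isAcyclic_iff_free_cycleGraph.mp h2.isAcyclic (n + 3) (by omega) ⟨⟨⟨fun i => φ.symm i, ?_⟩,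
    Subtype.val_injective.comp φ.symm.injective⟩⟩
  intro i j hij
  have h3 : C.Adj (φ.symm i) (φ.symm j) := φ.symm.map_adj_iff.mpr hij
  rw [deleteEdges_adj]
  refine ⟨h3.adj_sub, fun h => hab ?_⟩
  rw [Set.mem_singleton_iff] at h
  rw [← Subgraph.mem_edgeSet, ← h]
  exact h3

theorem maxDeg_le_iff [Finite V] (d : ℕ) :
    maxDeg G ≤ d ↔ ∀ v, (G.neighborSet v).ncard ≤ d := by
  let _ := Fintype.ofFinite V
  let _ := Classical.decRel G.Adj
  have h : ∀ v, (G.neighborSet v).ncard = G.degree v := fun v => by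
    rw [← card_neighborFinset_eq_degree, ← Set.ncard_coe_finset, coe_neighborFinset]
  simp_rw [h]
  exact ⟨fun hd v => (G.degree_le_maxDegree v).trans hd,
    fun hd => maxDegree_le_of_forall_degree_le _ _ hd⟩

theorem neighborSet_deleteEdges (e : Sym2 V) (v : V) :
    (G.deleteEdges {e}).neighborSet v = {w | G.Adj v w ∧ s(v, w) ≠ e} := by
  ext w; simp

theorem exists_edge_of_isTreePlusEdge [Finite V] {d : ℕ} (h : IsTreePlusEdge G d) :
    ∃ e ∈ G.edgeSet, ∀ v, {w | G.Adj v w ∧ s(v, w) ≠ e}.ncard ≤ d := by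
  obtain ⟨H, a, b, -, hdeg, hab, -, rfl⟩ := h
  refine ⟨s(a, b), by simp [hab], fun v => ?_⟩
  refine (Set.ncard_le_ncard ?_ (Set.toFinite _)).trans ((maxDeg_le_iff d).mp hdeg v)
  rintro w ⟨hw, hne⟩
  rw [sup_adj, edge_adj] at hw
  refine hw.resolve_right fun h => hne ?_
  rcases h.1 with ⟨rfl, rfl⟩ | ⟨rfl, rfl⟩
  · rfl
  · exact Sym2.eq_swap

theorem ncard_subgraph_neighborSet_le [Finite V] {d : ℕ} (H : G.Subgraph) (hd : maxDeg H.coe ≤ d)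
    (v : V) : {w | H.Adj v w}.ncard ≤ d := by
  by_cases hv : v ∈ H.verts
  · refine le_trans ?_ ((maxDeg_le_iff d).mp hd ⟨v, hv⟩)
    rw [← Set.ncard_image_of_injective _ Subtype.val_injective]
    refine Set.ncard_le_ncard ?_ (Set.toFinite _)
    exact fun w hw => ⟨⟨w, H.edge_vert (Subgraph.Adj.symm hw)⟩, hw, rfl⟩
  · have : {w | H.Adj v w} = ∅ :=
      Set.eq_empty_of_forall_notMem fun w hw => hv (H.edge_vert hw)
    simp [this]

theorem exists_edge_of_isTreeUnicyclicPlusEdge [Finite V] {d : ℕ}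
    (h : IsTreeUnicyclicPlusEdge G d) :
    ∃ e ∈ G.edgeSet, ∀ v, {w | G.Adj v w ∧ s(v, w) ≠ e}.ncard ≤ d := by
  obtain ⟨H, U, a, b, -, hH, -, hU, hdisj, -, ha, hb, hG⟩ := h
  have hab : a ≠ b := fun h => Set.disjoint_left.mp hdisj ha (h ▸ hb)
  have hadj : ∀ v w, G.Adj v w ↔ (H.Adj v w ∨ U.Adj v w) ∨ (edge a b).Adj v w := by
    intro v w
    conv_lhs => rw [hG]
    rfl
  refine ⟨s(a, b), (hadj a b).mpr (Or.inr (by simp [edge_adj, hab])), fun v => ?_⟩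
  have hsub : {w | G.Adj v w ∧ s(v, w) ≠ s(a, b)} ⊆ {w | H.Adj v w} ∪ {w | U.Adj v w} := by
    rintro w ⟨hw, hne⟩
    refine ((hadj v w).mp hw).resolve_right fun h => hne ?_
    rcases ((edge_adj ..).mp h).1 with ⟨rfl, rfl⟩ | ⟨rfl, rfl⟩
    · rfl
    · exact Sym2.eq_swap
  by_cases hv : v ∈ H.verts
  · refine (Set.ncard_le_ncard (fun w hw => ?_) (Set.toFinite _)).trans
      (ncard_subgraph_neighborSet_le H hH v)
    exact (hsub hw).resolve_right fun h => Set.disjoint_left.mp hdisj hv (U.edge_vert h)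
  · refine (Set.ncard_le_ncard (fun w hw => ?_) (Set.toFinite _)).trans
      (ncard_subgraph_neighborSet_le U hU v)
    exact (hsub hw).resolve_left fun h => hv (H.edge_vert h)

theorem maxDeg_coe_le [Finite V] {d : ℕ} (H : G.Subgraph) (e : Sym2 V)
    (hd : ∀ v, {w | G.Adj v w ∧ s(v, w) ≠ e}.ncard ≤ d)
    (hH : ∀ v w, H.Adj v w → s(v, w) ≠ e) : maxDeg H.coe ≤ d := by
  rw [maxDeg_le_iff]
  intro v
  refine le_trans ?_ (hd v)
  rw [← Set.ncard_image_of_injective _ Subtype.val_injective]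
  refine Set.ncard_le_ncard ?_ (Set.toFinite _)
  rintro _ ⟨w, hw, rfl⟩
  exact ⟨H.adj_sub hw, hH _ _ hw⟩

/-- On the cycle, deleting `e` leaves a spanning tree. Off the cycle, `e` is a bridge: `H` is the
component of the end cut off from the cycle and `U` is the rest. -/
theorem isTreePlusEdge_or_of_edge [Finite V] {d : ℕ} (hconn : G.Connected) (huni : IsUnicyclic G)
    {e : Sym2 V} (he : e ∈ G.edgeSet) (hd : ∀ v, {w | G.Adj v w ∧ s(v, w) ≠ e}.ncard ≤ d) :
    IsTreePlusEdge G d ∨ IsTreeUnicyclicPlusEdge G d := by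
  obtain ⟨C, hC, huniq⟩ := huni
  replace huniq : ∀ C', IsCycleSubgraph C' → C' = C := huniq
  by_cases heC : e ∈ C.edgeSet
  · left
    induction e using Sym2.ind with
    | _ a b =>
      refine ⟨G.deleteEdges {s(a, b)}, a, b, isTree_deleteEdges hconn hC huniq heC, ?_,
        G.ne_of_adj he, by simp, ?_⟩
      · rw [maxDeg_le_iff]
        intro v
        rw [neighborSet_deleteEdges]
        exact hd v
      · ext u v
        rw [sup_adj, deleteEdges_adj, edge_adj, Set.mem_singleton_iff, Sym2.eq_iff]
        constructor
        · intro h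
          by_cases h' : u = a ∧ v = b ∨ u = b ∧ v = a
          · exact Or.inr ⟨h', h.ne⟩
          · exact Or.inl ⟨h, h'⟩
        · rintro (h | ⟨⟨rfl, rfl⟩ | ⟨rfl, rfl⟩, -⟩)
          · exact h.1
          · exact he
          · exact G.adj_symm he
  · right
    obtain ⟨c⟩ := hconn.nonempty
    obtain ⟨c, c', hc, -⟩ := hC.exists_adj_ne c
    set G' := G.deleteEdges {e} with hG'
    have hG'adj : ∀ u v, G'.Adj u v ↔ G.Adj u v ∧ s(u, v) ≠ e := by simp [hG']
    obtain ⟨a, b, rfl, hca⟩ : ∃ a b, s(a, b) = e ∧ ¬ G'.Reachable a c := by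
      induction e using Sym2.ind with
      | _ a b =>
        have hb := isBridge_of_not_mem_cycle hconn hC huniq he heC
        rw [isBridge_iff] at hb
        by_cases h : G'.Reachable a c
        · exact ⟨b, a, Sym2.eq_swap, fun h' => hb (h.trans h'.symm)⟩
        · exact ⟨a, b, rfl, h⟩
    have hab : G.Adj a b := he
    have hnab : ¬ G'.Reachable a b :=
      isBridge_iff.mp (isBridge_of_not_mem_cycle hconn hC huniq he heC)
    let H : G.Subgraph :=
      { verts := {v | G'.Reachable a v}
        Adj := fun u v => G'.Reachable a u ∧ G'.Adj u v
        adj_sub := fun h => ((hG'adj _ _).mp h.2).1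
        edge_vert := fun h => h.1
        symm := ⟨fun u v h => ⟨h.1.trans h.2.reachable, h.2.symm⟩⟩ }
    let U : G.Subgraph :=
      { verts := {v | ¬ G'.Reachable a v}
        Adj := fun u v => ¬ G'.Reachable a u ∧ G'.Adj u v
        adj_sub := fun h => ((hG'adj _ _).mp h.2).1
        edge_vert := fun h => h.1
        symm := ⟨fun u v h => ⟨fun h' => h.1 (h'.trans h.2.reachable.symm), h.2.symm⟩⟩ }
    have hCadj : ∀ u v, C.Adj u v → G'.Adj u v := fun u v h => by
      rw [hG'adj]
      refine ⟨h.adj_sub, fun h' => heC ?_⟩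
      rw [← h']; exact h
    have hCreach : ∀ v ∈ C.verts, ¬ G'.Reachable a v := by
      intro v hv h
      have h1 := hC.preconnected ⟨v, hv⟩ ⟨c, C.edge_vert hc⟩
      let f : C.coe →g G' := ⟨fun v => v, fun {u v} h => hCadj _ _ h⟩
      exact hca (h.trans (h1.map f))
    have hCU : C ≤ U := ⟨hCreach, fun u v h => ⟨hCreach u (C.edge_vert h), hCadj u v h⟩⟩
    have hcoe : ∀ (K : G.Subgraph) (D : K.coe.Subgraph), IsCycleSubgraph D →
        Subgraph.coeSubgraph D = C := fun K D hD =>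
      huniq _ (hD.map ⟨K.hom, Subgraph.hom_injective⟩)
    refine ⟨H, U, a, b, ⟨?_, ?_⟩, ?_, ?_, ?_, ?_, ?_, Reachable.refl a, hnab, ?_⟩
    · rw [connected_iff_exists_forall_reachable]
      refine ⟨⟨a, Reachable.refl a⟩, ?_⟩
      have key : ∀ (u v : V) (p : G'.Walk u v) (hu : u ∈ H.verts) (hv : v ∈ H.verts),
          H.coe.Reachable ⟨u, hu⟩ ⟨v, hv⟩ := by
        intro u v p
        induction p with
        | nil => exact fun _ _ => Reachable.refl _
        | @cons u v w h p ih =>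
          intro hu hw
          have hv : v ∈ H.verts := Reachable.trans hu h.reachable
          have h1 : H.coe.Adj ⟨u, hu⟩ ⟨v, hv⟩ := ⟨hu, h⟩
          exact h1.reachable.trans (ih hv hw)
      rintro ⟨v, hv⟩
      obtain ⟨p⟩ : G'.Reachable a v := hv
      exact key a v p _ _
    · by_contra hcon
      obtain ⟨D, hD⟩ := exists_isCycleSubgraph_of_not_isAcyclic hcon
      have h1 := (Subgraph.coeSubgraph_le D).1 (show c ∈ (Subgraph.coeSubgraph D).verts by
        rw [hcoe H D hD]; exact C.edge_vert hc)
      exact hca h1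
    · exact maxDeg_coe_le H _ hd fun v w h => ((hG'adj v w).mp h.2).2
    · have h1 : Subgraph.coeSubgraph (U.restrict C) = C := by
        rw [Subgraph.coeSubgraph_restrict_eq, inf_eq_right.mpr hCU]
      refine ⟨U.restrict C, ?_, fun D hD => Subgraph.coeSubgraph_injective U ?_⟩
      · obtain ⟨m, hm, ⟨φ⟩⟩ := hC
        have ψ := Copy.isoSubgraphMap ⟨U.hom, Subgraph.hom_injective⟩ (U.restrict C)
        have h2 : (U.restrict C).map U.hom = C := h1
        refine ⟨m, hm, ⟨?_⟩⟩
        have χ : ((U.restrict C).map U.hom).coe ≃g cycleGraph m := by rw [h2]; exact φ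
        exact ψ.trans χ
      · rw [h1]
        exact hcoe U D hD
    · exact maxDeg_coe_le U _ hd fun v w h => ((hG'adj v w).mp h.2).2
    · exact Set.disjoint_left.mpr fun v h h' => h' h
    · exact Set.eq_univ_of_forall fun v => em _
    · ext u v
      change G.Adj u v ↔ ((G'.Reachable a u ∧ G'.Adj u v) ∨ (¬ G'.Reachable a u ∧ G'.Adj u v)) ∨
        (edge a b).Adj u v
      rw [← or_and_right, and_iff_right (em _), hG'adj, edge_adj, Ne, Sym2.eq_iff]
      constructor
      · intro h
        by_cases h' : u = a ∧ v = b ∨ u = b ∧ v = a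
        · exact Or.inr ⟨h', h.ne⟩
        · exact Or.inl ⟨h, h'⟩
      · rintro (h | ⟨⟨rfl, rfl⟩ | ⟨rfl, rfl⟩, -⟩)
        · exact h.1
        · exact hab
        · exact hab.symm

/-- A spanning tree of a connected unicyclic graph that misses one edge and contains all the edges
other than `e` at a given end of `e`. -/
theorem exists_spanning_tree [Finite V] (hconn : G.Connected) (huni : IsUnicyclic G) (e : Sym2 V)
    (c : V) (hc : c ∈ e) : ∃ (H : SimpleGraph V) (a b : V), H.IsTree ∧ H ≤ G ∧
      (∀ u v, G.Adj u v → H.Adj u v ∨ s(u, v) = s(a, b)) ∧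
      ∀ v, G.Adj c v → s(c, v) ≠ e → H.Adj c v := by
  obtain ⟨C, hC, huniq⟩ := huni
  have key : ∀ a b, C.Adj a b → (c ≠ a ∧ c ≠ b ∨ s(a, b) = e) →
      ∃ (H : SimpleGraph V) (a b : V), H.IsTree ∧ H ≤ G ∧
      (∀ u v, G.Adj u v → H.Adj u v ∨ s(u, v) = s(a, b)) ∧
      ∀ v, G.Adj c v → s(c, v) ≠ e → H.Adj c v := by
    intro a b hab h
    refine ⟨G.deleteEdges {s(a, b)}, a, b, isTree_deleteEdges hconn hC huniq hab,
      deleteEdges_le _, ?_, ?_⟩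
    · intro u v huv
      by_cases h : s(u, v) = s(a, b)
      · exact Or.inr h
      · exact Or.inl (deleteEdges_adj.mpr ⟨huv, h⟩)
    · intro v hv hne
      refine deleteEdges_adj.mpr ⟨hv, fun h' => ?_⟩
      rw [Set.mem_singleton_iff] at h'
      rcases h with ⟨h1, h2⟩ | h
      · rcases Sym2.eq_iff.mp h' with h | h
        · exact h1 h.1
        · exact h2 h.1
      · exact hne (h'.trans h)
  -- Delete `e` itself if it lies on the cycle, and otherwise a cycle edge that avoids `c`.
  by_cases heC : e ∈ C.edgeSet
  · induction e using Sym2.ind with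
    | _ a b => exact key a b heC (Or.inr rfl)
  · obtain ⟨a, b, hab, h1, h2⟩ := hC.exists_adj_ne c
    exact key a b hab (Or.inl ⟨h1, h2⟩)

/-- A tree has an order of its vertices in which each vertex has at most one earlier neighbour, and
which begins with a given vertex and its neighbours. -/
theorem exists_order_of_isTree [Finite V] {H : SimpleGraph V} (hH : H.IsTree) (c : V) :
    ∃ σ : V → ℕ, Function.Injective σ ∧
      (∀ v u u', H.Adj u v → H.Adj u' v → σ u < σ v → σ u' < σ v → u = u') ∧
      ∀ u w, H.Adj c w → σ u < σ w → u = c ∨ H.Adj c u := by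
  classical
  obtain ⟨n, ⟨φ⟩⟩ := Finite.exists_equiv_fin V
  -- Order by distance from `c`, with ties broken by `φ v < n`.
  let σ : V → ℕ := fun v => n * H.dist c v + φ v
  have hle : ∀ u v, σ u < σ v → H.dist c u ≤ H.dist c v := by
    intro u v h
    by_contra hlt
    push Not at hlt
    have h1 : n * (H.dist c v + 1) ≤ n * H.dist c u := Nat.mul_le_mul_left _ hlt
    have h2 := (φ v).2
    simp only [σ] at h
    rw [mul_add] at h1
    omega
  refine ⟨σ, fun u v h => ?_, ?_, ?_⟩
  · have h1 : σ u % n = σ v % n := congrArg (· % n) h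
    simp only [σ, Nat.mul_add_mod, Nat.mod_eq_of_lt (φ u).2, Nat.mod_eq_of_lt (φ v).2] at h1
    exact φ.injective (Fin.ext h1)
  · have key : ∀ u v, H.Adj u v → σ u < σ v → ∃ p : H.Walk c v, p.IsPath ∧ p.penultimate = u := by
      intro u v huv h
      obtain ⟨p, hp⟩ := hH.connected.exists_walk_length_eq_dist c u
      have h1 := hH.dist_eq_dist_add_one_of_adj c huv
      have h2 := hle u v h
      refine ⟨p.concat huv, ?_, by simp⟩
      refine Walk.isPath_of_length_eq_dist _ ?_
      rw [Walk.length_concat, hp]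
      omega
    intro v u u' hu hu' h h'
    obtain ⟨p, hp, rfl⟩ := key u v hu h
    obtain ⟨q, hq, rfl⟩ := key u' v hu' h'
    rw [(hH.existsUnique_path c v).unique hp hq]
  · intro u w hw h
    have h1 := hle u w h
    rw [dist_eq_one_iff_adj.mpr hw] at h1
    rcases Nat.le_one_iff_eq_zero_or_eq_one.mp h1 with h2 | h2
    · left
      exact ((hH.connected.dist_eq_zero_iff).mp h2).symm
    · right
      exact dist_eq_one_iff_adj.mp h2

end LSS

end Graphs

namespace LSS

section

open SimpleGraph MvPolynomial

/-! ### Generators of `L_G(d)` and the upper bound for its height. -/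

section Ideals

variable (k : Type*) [Field k] {V : Type*} (d : ℕ)

/-- The generator of `L_G(d)` that belongs to an edge. -/
noncomputable def edgePoly : Sym2 V → MvPolynomial (V × Fin d) k :=
  Sym2.lift ⟨lssPoly k d, fun _ _ => Finset.sum_congr rfl fun _ _ => mul_comm _ _⟩

theorem edgePoly_mk (u v : V) : edgePoly k d s(u, v) = lssPoly k d u v := rfl

theorem lssIdeal_eq_span (G : SimpleGraph V) :
    lssIdeal k G d = Ideal.span (edgePoly k d '' G.edgeSet) := by
  refine congrArg Ideal.span (Set.ext fun f => ⟨?_, ?_⟩)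
  · rintro ⟨i, j, hij, rfl⟩
    exact ⟨s(i, j), hij, rfl⟩
  · rintro ⟨e, he, rfl⟩
    induction e using Sym2.ind with
    | _ i j => exact ⟨i, j, he, rfl⟩

theorem spanFinrank_span_image_le {R ι : Type*} [CommRing R] (f : ι → R) {s : Set ι}
    (hs : s.Finite) : Submodule.spanFinrank (Ideal.span (f '' s)) ≤ s.ncard :=
  (Submodule.spanFinrank_span_le_ncard_of_finite (hs.image f)).trans (Set.ncard_image_le hs)

variable {k d}

theorem edgePoly_mem {G : SimpleGraph V} {e : Sym2 V} (he : e ∈ G.edgeSet) :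
    edgePoly k d e ∈ lssIdeal k G d := by
  rw [lssIdeal_eq_span]
  exact Ideal.subset_span ⟨e, he, rfl⟩

theorem lssPoly_mem {G : SimpleGraph V} {u v : V} (h : G.Adj u v) :
    lssPoly k d u v ∈ lssIdeal k G d := edgePoly_mem (e := s(u, v)) h

theorem constantCoeff_edgePoly (e : Sym2 V) : constantCoeff (edgePoly k d e) = 0 := by
  induction e using Sym2.ind with
  | _ u v => simp [edgePoly_mk, lssPoly]

theorem lssIdeal_le_ker (G : SimpleGraph V) :
    lssIdeal k G d ≤ RingHom.ker (constantCoeff (R := k) (σ := V × Fin d)) := by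
  rw [lssIdeal_eq_span, Ideal.span_le]
  rintro _ ⟨e, -, rfl⟩
  exact constantCoeff_edgePoly e

theorem lssPoly_mem_of_forall_X_mem {R : Type*} [CommRing R] (f : MvPolynomial (V × Fin d) k →+* R)
    (J : Ideal R) {u : V} (hu : ∀ l, f (X (u, l)) ∈ J) (v : V) : f (lssPoly k d u v) ∈ J := by
  rw [lssPoly, map_sum]
  refine Ideal.sum_mem _ fun l _ => ?_
  rw [map_mul]
  exact J.mul_mem_right _ (hu l)

variable (k d)

/-- Enlarge the ideal by all variables at `T`; the edges meeting `T` become redundant, and Krull's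
height theorem applies. -/
theorem height_lssIdeal_le [Finite V] (G : SimpleGraph V) (T : Set V) :
    (lssIdeal k G d).height ≤
      ((d * T.ncard + {e ∈ G.edgeSet | ∀ v ∈ e, v ∉ T}.ncard : ℕ) : ℕ∞) := by
  let A : Ideal (MvPolynomial (V × Fin d) k) := Ideal.span (X '' (T ×ˢ Set.univ))
  let B : Ideal (MvPolynomial (V × Fin d) k) :=
    Ideal.span (edgePoly k d '' {e ∈ G.edgeSet | ∀ v ∈ e, v ∉ T})
  have hle : lssIdeal k G d ≤ A ⊔ B := by
    rw [lssIdeal_eq_span, Ideal.span_le]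
    rintro _ ⟨e, he, rfl⟩
    by_cases h : ∀ v ∈ e, v ∉ T
    · exact Ideal.mem_sup_right (Ideal.subset_span ⟨e, ⟨he, h⟩, rfl⟩)
    · push Not at h
      obtain ⟨v, hv, hvT⟩ := h
      obtain ⟨w, rfl⟩ := hv
      refine Ideal.mem_sup_left
        (lssPoly_mem_of_forall_X_mem (RingHom.id _) A (u := v) (fun l => ?_) w)
      exact Ideal.subset_span ⟨(v, l), ⟨hvT, trivial⟩, rfl⟩
  have hker : A ⊔ B ≤ RingHom.ker (constantCoeff (R := k) (σ := V × Fin d)) := by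
    refine sup_le (Ideal.span_le.mpr ?_) (Ideal.span_le.mpr ?_)
    · rintro _ ⟨p, -, rfl⟩
      exact constantCoeff_X _ _
    · rintro _ ⟨e, -, rfl⟩
      exact constantCoeff_edgePoly e
  have hne : A ⊔ B ≠ ⊤ := fun h =>
    (RingHom.ker_ne_top (constantCoeff (R := k) (σ := V × Fin d))) (top_le_iff.mp (h ▸ hker))
  refine (Ideal.height_mono hle).trans ((Ideal.height_le_spanFinrank _ hne).trans ?_)
  have hAB : A ⊔ B = Ideal.span (X '' (T ×ˢ Set.univ) ∪
      edgePoly k d '' {e ∈ G.edgeSet | ∀ v ∈ e, v ∉ T}) := (Ideal.span_union _ _).symm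
  rw [hAB]
  refine Nat.cast_le.mpr ((Submodule.spanFinrank_span_le_ncard_of_finite (Set.toFinite _)).trans ?_)
  refine (Set.ncard_union_le _ _).trans (add_le_add ?_ (Set.ncard_image_le (Set.toFinite _)))
  refine (Set.ncard_image_le (Set.toFinite _)).trans ?_
  rw [Set.ncard_prod, Set.ncard_univ, Nat.card_fin, mul_comm]

theorem pderiv_edgePoly_constantCoeff (p : V × Fin d) (e : Sym2 V) :
    constantCoeff (pderiv p (edgePoly k d e)) = 0 := by
  induction e using Sym2.ind with
  | _ u v =>
    rw [edgePoly_mk, lssPoly, map_sum, map_sum]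
    refine Finset.sum_eq_zero fun l _ => ?_
    simp [Derivation.leibniz]

theorem pderiv_pderiv_edgePoly (l₀ : Fin d) {i j : V} (hij : i ≠ j) (e : Sym2 V) :
    constantCoeff (pderiv (i, l₀) (pderiv (j, l₀) (edgePoly k d e))) =
      open Classical in if e = s(i, j) then 1 else 0 := by
  classical
  induction e using Sym2.ind with
  | _ u v =>
    have h : ∀ l : Fin d, constantCoeff (pderiv (i, l₀) (pderiv (j, l₀)
        (X (u, l) * X (v, l) : MvPolynomial (V × Fin d) k))) =
        if l = l₀ then (if s(u, v) = s(i, j) then 1 else 0) else 0 := by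
      intro l
      rw [Derivation.leibniz, pderiv_X, pderiv_X, map_add]
      simp only [Pi.single_apply, Prod.mk.injEq, smul_eq_mul, Sym2.eq_iff]
      by_cases hl : l = l₀
      · subst hl
        by_cases h1 : u = i <;> by_cases h2 : v = j <;> by_cases h3 : u = j <;>
          by_cases h4 : v = i <;> simp_all
      · simp [hl]
    rw [edgePoly_mk, lssPoly, map_sum, map_sum, map_sum]
    simp_rw [h]
    simp

/-- Second derivatives at the origin separate the edge polynomials. Elements of the ideal vanish
there to order two, so these derivatives see a multiplier only through its constant term, and any
generating set must map onto a spanning set of `k^E`. -/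
theorem spanFinrank_lssIdeal [Finite V] (hd : 0 < d) (G : SimpleGraph V) :
    (lssIdeal k G d).spanFinrank = G.edgeSet.ncard := by
  classical
  have := Fintype.ofFinite V
  refine le_antisymm ?_ ?_
  · rw [lssIdeal_eq_span]
    exact spanFinrank_span_image_le _ (Set.toFinite _)
  let l₀ : Fin d := ⟨0, hd⟩
  have hends : ∀ e : G.edgeSet, ∃ p : V × V, p.1 ≠ p.2 ∧ s(p.1, p.2) = e.1 := by
    rintro ⟨e, he⟩
    induction e using Sym2.ind with
    | _ u v => exact ⟨(u, v), G.ne_of_adj he, rfl⟩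
  choose q hq hqe using hends
  let Φ : MvPolynomial (V × Fin d) k → G.edgeSet → k := fun g e =>
    constantCoeff (pderiv ((q e).1, l₀) (pderiv ((q e).2, l₀) g))
  have hΦadd : ∀ g h, Φ (g + h) = Φ g + Φ h := fun g h => by ext e; simp [Φ]
  have hfirst : ∀ g ∈ lssIdeal k G d, ∀ p, constantCoeff (pderiv p g) = 0 := by
    intro g hg p
    have hg0 := hg
    rw [lssIdeal_eq_span] at hg
    induction hg using Submodule.span_induction with
    | mem g h =>
      obtain ⟨e, -, rfl⟩ := h
      exact pderiv_edgePoly_constantCoeff k d p e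
    | zero => simp
    | add g h hg' hh' ihg ihh =>
      replace hg' : g ∈ lssIdeal k G d := by rw [lssIdeal_eq_span]; exact hg'
      replace hh' : h ∈ lssIdeal k G d := by rw [lssIdeal_eq_span]; exact hh'
      simp [ihg hg', ihh hh']
    | smul a g hg' ihg =>
      replace hg' : g ∈ lssIdeal k G d := by rw [lssIdeal_eq_span]; exact hg'
      have h0 : constantCoeff g = 0 := lssIdeal_le_ker G hg'
      simp [Derivation.leibniz, ihg hg', h0]
  have hΦsmul : ∀ a : MvPolynomial (V × Fin d) k, ∀ g ∈ lssIdeal k G d,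
      Φ (a • g) = constantCoeff a • Φ g := by
    intro a g hg
    have h0 : constantCoeff g = 0 := lssIdeal_le_ker G hg
    ext e
    simp [Φ, Derivation.leibniz, hfirst g hg, h0]
  have hfg : Submodule.FG (lssIdeal k G d) := IsNoetherian.noetherian _
  obtain ⟨s, hs, hspan⟩ := hfg.exists_span_finset_card_eq_spanFinrank
  have hmem : ∀ g ∈ lssIdeal k G d, Φ g ∈ Submodule.span k ((s.image Φ : Finset _) : Set _) := by
    intro g hg
    have hg0 := hg
    rw [← hspan] at hg
    induction hg using Submodule.span_induction with
    | mem g h => exact Submodule.subset_span (by simpa using ⟨g, h, rfl⟩)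
    | zero =>
      have : Φ 0 = 0 := by ext e; simp [Φ]
      rw [this]; exact zero_mem _
    | add g h hg' hh' ihg ihh =>
      rw [hspan] at hg' hh'
      rw [hΦadd]
      exact add_mem (ihg hg') (ihh hh')
    | smul a g hg' ihg =>
      rw [hspan] at hg'
      rw [hΦsmul a g hg']
      exact Submodule.smul_mem _ _ (ihg hg')
  have hΦe : ∀ e : G.edgeSet, Φ (edgePoly k d e.1) = Pi.single e 1 := by
    intro e
    ext e'
    simp only [Φ]
    rw [pderiv_pderiv_edgePoly k d l₀ (hq e'), hqe, Pi.single_apply]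
    simp only [Subtype.coe_inj, eq_comm]
  have htop : Submodule.span k ((s.image Φ : Finset _) : Set (G.edgeSet → k)) = ⊤ := by
    rw [eq_top_iff, ← (Pi.basisFun k G.edgeSet).span_eq, Submodule.span_le]
    rintro _ ⟨e, rfl⟩
    rw [Pi.basisFun_apply, ← hΦe e]
    exact hmem _ (edgePoly_mem e.2)
  have h1 := finrank_span_finset_le_card (R := k) (s.image Φ)
  rw [Set.finrank, htop, finrank_top, Module.finrank_fintype_fun_eq_card] at h1
  rw [← hs, ← Nat.card_coe_set_eq, Nat.card_eq_fintype_card]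
  exact h1.trans Finset.card_image_le

end Ideals

end

end LSS

namespace LSS

/-! ### The generic point of a prime, and localization. -/

section

open SimpleGraph MvPolynomial

/-- The edge outside the tree adds an earlier neighbour only at its later end, which is `z`. -/
theorem exists_priorNeighbors_bound {K V : Type*} [Field K] {d : ℕ} [Finite V]
    {G H : SimpleGraph V} {a b : V}
    (hGH : ∀ u v, G.Adj u v → H.Adj u v ∨ s(u, v) = s(a, b)) (σ : V → ℕ)
    (hσ : ∀ v u u', H.Adj u v → H.Adj u' v → σ u < σ v → σ u' < σ v → u = u')
    (x : V → Fin d → K) :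
    ∃ z, (priorNeighbors G σ x z).ncard ≤ 2 ∧
      ∀ v, v ≠ z → (priorNeighbors G σ x v).ncard ≤ 1 := by
  wlog hab : σ a ≤ σ b generalizing a b
  · exact this (a := b) (b := a) (fun u v h => (hGH u v h).imp_right fun h => h.trans Sym2.eq_swap)
      (not_le.mp hab).le
  have hone : ∀ v, {u | H.Adj u v ∧ σ u < σ v}.ncard ≤ 1 := fun v =>
    (Set.ncard_le_one (Set.toFinite _)).mpr fun u hu u' hu' => hσ v u u' hu.1 hu'.1 hu.2 hu'.2
  have hend : ∀ u v, σ u < σ v → s(u, v) = s(a, b) → u = a ∧ v = b := by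
    intro u v huv h
    rcases Sym2.eq_iff.mp h with h | ⟨rfl, rfl⟩
    · exact h
    · exact absurd huv (not_lt.mpr hab)
  refine ⟨b, ?_, fun v hv => ?_⟩
  · refine (Set.ncard_le_ncard (t := insert a {u | H.Adj u b ∧ σ u < σ b}) ?_
      (Set.toFinite _)).trans ((Set.ncard_insert_le _ _).trans (Nat.succ_le_succ (hone b)))
    rintro u ⟨hu, hlt, -⟩
    rcases hGH u b hu with h | h
    · exact Or.inr ⟨h, hlt⟩
    · exact Or.inl (hend u b hlt h).1
  · refine (Set.ncard_le_ncard ?_ (Set.toFinite _)).trans (hone v)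
    rintro u ⟨hu, hlt, -⟩
    rcases hGH u v hu with h | h
    · exact ⟨h, hlt⟩
    · exact absurd (hend u v hlt h).2 hv

section Primes

variable {k : Type*} [Field k] {V : Type*} {d : ℕ}

/-- The vector of residue classes of the variables that belong to `v`. -/
noncomputable def genericVector (P : Ideal (MvPolynomial (V × Fin d) k)) [P.IsPrime] (v : V) :
    Fin d → P.ResidueField :=
  fun l => algebraMap (MvPolynomial (V × Fin d) k) P.ResidueField (X (v, l))

theorem genericVector_dotProduct {G : SimpleGraph V} {P : Ideal (MvPolynomial (V × Fin d) k)}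
    [P.IsPrime] (hP : lssIdeal k G d ≤ P) {u v : V} (h : G.Adj u v) :
    genericVector P u ⬝ᵥ genericVector P v = 0 := by
  have h1 : algebraMap (MvPolynomial (V × Fin d) k) P.ResidueField (lssPoly k d u v) = 0 :=
    Ideal.algebraMap_residueField_eq_zero.mpr (hP (lssPoly_mem h))
  simpa [lssPoly, genericVector, dotProduct] using h1

theorem le_height_of_lssIdeal_le [Fintype V] (hd : 3 ≤ d) {G H : SimpleGraph V} {a b c : V}
    (hH : H.IsTree) (hHG : H ≤ G) (hGH : ∀ u v, G.Adj u v → H.Adj u v ∨ s(u, v) = s(a, b))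
    (hfree : ∀ u v w, G.Adj u v → G.Adj v w → ¬ G.Adj u w)
    (P : Ideal (MvPolynomial (V × Fin d) k)) [P.IsPrime] (hP : lssIdeal k G d ≤ P) (ε : ℕ)
    (hε : ε = 0 ∨ ε = 1 ∧ genericVector P c = 0 ∧ ∃ W : Finset V, W.card ≤ d ∧
      (∀ w ∈ W, H.Adj c w ∧ genericVector P w ≠ 0) ∧
      ¬ LinearIndependent P.ResidueField (fun w : W => genericVector P w)) :
    ((d * {v | genericVector P v = 0}.ncard +
      {e ∈ G.edgeSet | ∀ v ∈ e, genericVector P v ≠ 0}.ncard + ε : ℕ) : ℕ∞) ≤ P.height := by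
  obtain ⟨σ, hinj, hσ, hσc⟩ := exists_order_of_isTree hH c
  obtain ⟨z, hz, hnz⟩ := exists_priorNeighbors_bound hGH σ hσ (genericVector P)
  obtain ⟨w, hw⟩ : ∃ w, ε = 0 ∨ ε = 1 ∧ genericVector P w ≠ 0 ∧
      (priorNeighbors G σ (genericVector P) w).ncard = 0 ∧
      priorRank k σ (genericVector P) w + 1 ≤ d := by
    rcases hε with h | ⟨h1, hc, W, hWd, hW, hli⟩
    · exact ⟨c, Or.inl h⟩
    · obtain ⟨w, hw, hr⟩ := exists_priorRank_lt_of_not_linearIndependent (k := k) σ hinj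
        (genericVector P) W hWd hli
      refine ⟨w, Or.inr ⟨h1, (hW w hw).2, ?_, hr⟩⟩
      rw [Set.ncard_eq_zero (Set.toFinite _), Set.eq_empty_iff_forall_notMem]
      rintro u ⟨huw, hlt, hu⟩
      -- What precedes `w` is `c`, whose vector is zero, or neighbours of `c`, which are not
      -- adjacent to `w` for lack of triangles.
      rcases hσc u w (hW w hw).1 hlt with rfl | hcu
      · exact hu hc
      · exact hfree c u w (hHG hcu) huw (hHG (hW w hw).1)
  have h1 := sum_priorRank_add_le (k := k) hd G σ hinj (genericVector P)
    (fun u v h => genericVector_dotProduct hP h) z hz hnz ε w hw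
  obtain ⟨B, hB, hBx⟩ := exists_finset_card_le_sum_priorRank (k := k) σ hinj (genericVector P)
  have h2 := card_le_height_add_card P B fun p => hBx p.1 p.2
  rw [Nat.card_prod, Nat.card_fin, Nat.card_eq_fintype_card, mul_comm] at h2
  have h3 := (Nat.cast_le (α := ℕ∞)).mpr h1
  have h4 : ((B.card : ℕ) : ℕ∞) ≤ ((∑ v, priorRank k σ (genericVector P) v : ℕ) : ℕ∞) :=
    Nat.cast_le.mpr hB
  have h5 := h3.trans (h2.trans (add_le_add le_rfl h4))
  rw [add_comm P.height, add_assoc, add_assoc, Nat.cast_add,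
    ENat.add_le_add_iff_left (ENat.natCast_ne_top _), ← add_assoc] at h5
  exact h5

/-- Covering the edges by those away from a set of vertices and those at its vertices. -/
theorem ncard_edgeSet_le [Finite V] (G : SimpleGraph V) (T : Finset V) (e : Sym2 V)
    (D : Set (Sym2 V)) (hD : e ∈ {e ∈ G.edgeSet | ∀ v ∈ e, v ∉ T} ∪ D) (c : V) :
    G.edgeSet.ncard ≤ {e ∈ G.edgeSet | ∀ v ∈ e, v ∉ T}.ncard + D.ncard +
      ∑ v ∈ T, {w | G.Adj v w ∧ s(v, w) ≠ e ∧ (v = c → w ∉ T)}.ncard := by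
  classical
  have hsub : G.edgeSet ⊆ ({e ∈ G.edgeSet | ∀ v ∈ e, v ∉ T} ∪ D) ∪
      ⋃ v ∈ T, (fun w => s(v, w)) '' {w | G.Adj v w ∧ s(v, w) ≠ e ∧ (v = c → w ∉ T)} := by
    intro f hf
    by_cases hfe : f = e
    · exact Or.inl (hfe ▸ hD)
    by_cases h : ∀ v ∈ f, v ∉ T
    · exact Or.inl (Or.inl ⟨hf, h⟩)
    right
    push Not at h
    obtain ⟨v, ⟨w, rfl⟩, hv⟩ := h
    -- An edge from `c` to another vertex of `T` is charged to that vertex, so at `c` only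
    -- neighbours outside `T` count.
    by_cases hw : v = c ∧ w ∈ T
    · refine Set.mem_biUnion hw.2 ⟨v, ⟨G.adj_symm hf, ?_, ?_⟩, Sym2.eq_swap⟩
      · rwa [Sym2.eq_swap]
      · intro hwc
        exact absurd (hw.1.trans hwc.symm) (G.ne_of_adj hf)
    · exact Set.mem_biUnion hv ⟨w, ⟨hf, hfe, fun h h' => hw ⟨h, h'⟩⟩, rfl⟩
  refine (Set.ncard_le_ncard hsub (Set.toFinite _)).trans ((Set.ncard_union_le _ _).trans
    (add_le_add (Set.ncard_union_le _ _) ?_))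
  refine (Finset.set_ncard_biUnion_le _ _).trans (Finset.sum_le_sum fun v _ => ?_)
  exact Set.ncard_image_le (Set.toFinite _)

/-- Cramer's rule: the determinant of the `d` neighbouring vectors times each variable of `c` lies
in `L_G(d)`, and independence over the residue field makes the determinant a unit at `P`. -/
theorem X_mem_map_lssIdeal {G : SimpleGraph V} (P : Ideal (MvPolynomial (V × Fin d) k))
    [P.IsPrime] (c : V) (W : Finset V) (hW : W.card = d) (hadj : ∀ w ∈ W, G.Adj c w)
    (hli : LinearIndependent P.ResidueField (fun w : W => genericVector P w)) (l : Fin d) :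
    algebraMap (MvPolynomial (V × Fin d) k) (Localization.AtPrime P) (X (c, l)) ∈
      (lssIdeal k G d).map (algebraMap (MvPolynomial (V × Fin d) k) (Localization.AtPrime P)) := by
  classical
  let φ : Fin d ≃ W := (W.equivFinOfCardEq hW).symm
  let M : Matrix (Fin d) (Fin d) (MvPolynomial (V × Fin d) k) :=
    fun i l => X ((φ i : V), l)
  have hM : M.det ∉ P := by
    intro hdet
    have h1 : LinearIndependent P.ResidueField
        ((algebraMap (MvPolynomial (V × Fin d) k) P.ResidueField).mapMatrix M).row :=
      hli.comp φ φ.injective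
    rw [Matrix.linearIndependent_rows_iff_isUnit, Matrix.isUnit_iff_isUnit_det,
      ← RingHom.map_det] at h1
    exact h1.ne_zero (Ideal.algebraMap_residueField_eq_zero.mpr hdet)
  have hmem : M.det * X (c, l) ∈ lssIdeal k G d := by
    have h1 : M.det • (fun l => (X (c, l) : MvPolynomial (V × Fin d) k)) =
        M.adjugate.mulVec (M.mulVec fun l => X (c, l)) := by
      rw [Matrix.mulVec_mulVec, Matrix.adjugate_mul, Matrix.smul_mulVec, Matrix.one_mulVec]
    have h2 := congrFun h1 l
    rw [Pi.smul_apply, smul_eq_mul] at h2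
    rw [h2]
    rw [Matrix.mulVec, dotProduct]
    refine (lssIdeal k G d).sum_mem fun i _ => (lssIdeal k G d).mul_mem_left _ ?_
    exact lssPoly_mem (hadj _ (φ i).2).symm
  have hunit : IsUnit (algebraMap (MvPolynomial (V × Fin d) k) (Localization.AtPrime P) M.det) :=
    IsLocalization.map_units (M := P.primeCompl) _ ⟨M.det, hM⟩
  rw [← Ideal.unit_mul_mem_iff_mem _ hunit, ← map_mul]
  exact Ideal.mem_map_of_mem _ hmem

/-- A prime over the localized ideal contracts to a prime between `I` and `P`, whose height is at
least that of `P` by minimality. -/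
theorem height_le_height_map_of_mem_minimalPrimes {R : Type*} [CommRing R] (I P : Ideal R)
    [P.IsPrime] (hP : P ∈ I.minimalPrimes) :
    P.height ≤ (I.map (algebraMap R (Localization.AtPrime P))).height := by
  rw [Ideal.height_eq_inf_minimalPrimes (I := I.map _)]
  refine le_iInf₂ fun Q hQ => ?_
  have hQp : Q.IsPrime := hQ.1.1
  rw [← IsLocalization.height_under P.primeCompl Q]
  refine Ideal.height_mono (hP.2 ⟨inferInstance, ?_⟩ ?_)
  · exact Ideal.map_le_iff_le_comap.mp hQ.1.2
  · intro r hr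
    by_contra hrP
    exact hQp.ne_top (Ideal.eq_top_of_isUnit_mem _ hr
      (IsLocalization.map_units (M := P.primeCompl) _ ⟨r, hrP⟩))

theorem isCompleteIntersection_map [Finite V] (G : SimpleGraph V)
    (P : Ideal (MvPolynomial (V × Fin d) k)) [P.IsPrime] (hP : P ∈ (lssIdeal k G d).minimalPrimes)
    (h : (((lssIdeal k G d).map (algebraMap (MvPolynomial (V × Fin d) k)
      (Localization.AtPrime P))).spanFinrank : ℕ∞) ≤
      P.height) :
    IsCompleteIntersection ((lssIdeal k G d).map
      (algebraMap (MvPolynomial (V × Fin d) k) (Localization.AtPrime P))) := by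
  have hloc : IsNoetherianRing (Localization.AtPrime P) :=
    IsLocalization.isNoetherianRing P.primeCompl _ inferInstance
  refine ⟨IsNoetherian.noetherian _, le_antisymm
    (h.trans (height_le_height_map_of_mem_minimalPrimes _ P hP)) ?_⟩
  refine Ideal.height_le_spanFinrank _ fun htop => ?_
  have h1 : (lssIdeal k G d).map
      (algebraMap (MvPolynomial (V × Fin d) k) (Localization.AtPrime P)) ≤
      IsLocalRing.maximalIdeal (Localization.AtPrime P) := by
    rw [← Localization.AtPrime.map_eq_maximalIdeal]
    exact Ideal.map_mono hP.1.2
  rw [htop] at h1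
  exact (IsLocalRing.maximalIdeal.isMaximal (Localization.AtPrime P)).ne_top (top_le_iff.mp h1)

end Primes

end

end LSS

namespace LSS

/-! ### Almost complete intersection versus deleting one edge. -/

section Criterion

open SimpleGraph MvPolynomial

variable (k : Type*) [Field k] {V : Type*} {d : ℕ} {G : SimpleGraph V}

theorem not_adj_of_free_cycleGraph_three (h : (cycleGraph 3).Free G) (u v w : V)
    (huv : G.Adj u v) (hvw : G.Adj v w) : ¬ G.Adj u w := by
  classical
  intro huw
  rw [cycleGraph_three_eq_top] at h
  refine (not_cliqueFree_iff_top_isContained 3).not_right.mpr h {u, v, w} ?_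
  exact is3Clique_triple_iff.mpr ⟨huv, huw, hvw⟩

theorem ncard_edges_add_ncard_neighborSet_le [Finite V] (G : SimpleGraph V) (a : V) :
    {e ∈ G.edgeSet | ∀ v ∈ e, v ∉ ({a} : Set V)}.ncard + (G.neighborSet a).ncard ≤
      G.edgeSet.ncard := by
  rw [← Set.ncard_image_of_injective (G.neighborSet a) (Sym2.mkEmbedding a).injective,
    ← Set.ncard_union_eq ?_ (Set.toFinite _) (Set.toFinite _)]
  · refine Set.ncard_le_ncard ?_ (Set.toFinite _)
    rintro e (he | ⟨v, hv, rfl⟩)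
    · exact he.1
    · exact hv
  · rw [Set.disjoint_left]
    rintro _ ⟨-, h⟩ ⟨v, hv, rfl⟩
    exact h a (Sym2.mem_mk_left a v) rfl

theorem ncard_edges_add_ncard_neighborSet_add_le [Finite V] (G : SimpleGraph V) {a b : V}
    (hne : a ≠ b) (hab : ¬ G.Adj a b) :
    {e ∈ G.edgeSet | ∀ v ∈ e, v ∉ ({a, b} : Set V)}.ncard + (G.neighborSet b).ncard +
      (G.neighborSet a).ncard ≤ G.edgeSet.ncard := by
  refine le_trans ?_ (ncard_edges_add_ncard_neighborSet_le G a)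
  refine Nat.add_le_add_right ?_ _
  rw [← Set.ncard_image_of_injective (G.neighborSet b) (Sym2.mkEmbedding b).injective,
    ← Set.ncard_union_eq ?_ (Set.toFinite _) (Set.toFinite _)]
  · refine Set.ncard_le_ncard ?_ (Set.toFinite _)
    rintro e (he | ⟨v, hv, rfl⟩)
    · exact ⟨he.1, fun v hv h => he.2 v hv (Or.inl h)⟩
    · refine ⟨hv, fun w hw h => ?_⟩
      rw [Set.mem_singleton_iff] at h
      subst h
      rcases Sym2.mem_iff.mp hw with h | h
      · exact hne h
      · exact hab (h ▸ hv.symm)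
  · rw [Set.disjoint_left]
    rintro _ ⟨-, h⟩ ⟨v, hv, rfl⟩
    exact h b (Sym2.mem_mk_left b v) (Or.inr rfl)

theorem exists_edge_of_isAlmostCompleteIntersection [Finite V] (hd : 0 < d)
    (hfree : ∀ u v w, G.Adj u v → G.Adj v w → ¬ G.Adj u w) (hdeg : d < maxDeg G)
    (h : IsAlmostCompleteIntersection (lssIdeal k G d)) :
    ∃ e ∈ G.edgeSet, ∀ v, {w | G.Adj v w ∧ s(v, w) ≠ e}.ncard ≤ d := by
  have hrank := h.2.1
  rw [spanFinrank_lssIdeal k d hd] at hrank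
  have hT : ∀ T : Set V, G.edgeSet.ncard ≤
      d * T.ncard + {e ∈ G.edgeSet | ∀ v ∈ e, v ∉ T}.ncard + 1 := by
    intro T
    have h1 := add_le_add_left (height_lssIdeal_le k d G T) 1
    rw [← hrank] at h1
    exact_mod_cast h1
  have hone : ∀ a, (G.neighborSet a).ncard ≤ d + 1 := by
    intro a
    have h1 := hT {a}
    have h2 := ncard_edges_add_ncard_neighborSet_le G a
    rw [Set.ncard_singleton] at h1
    omega
  have htwo : ∀ a b, d < (G.neighborSet a).ncard → d < (G.neighborSet b).ncard → a ≠ b →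
      G.Adj a b := by
    intro a b ha hb hne
    -- Non-adjacent `a` and `b` would account for at least `2 * d + 2` edges, while `T = {a, b}`
    -- allows only `2 * d + 1`.
    by_contra hab
    have h1 := hT {a, b}
    have h2 := ncard_edges_add_ncard_neighborSet_add_le G hne hab
    rw [Set.ncard_pair hne] at h1
    omega
  obtain ⟨a, ha⟩ : ∃ a, d < (G.neighborSet a).ncard := by
    by_contra hcon
    push Not at hcon
    exact absurd ((maxDeg_le_iff d).mpr hcon) (not_le.mpr hdeg)
  obtain ⟨b, hab, hb⟩ : ∃ b, G.Adj a b ∧ ∀ v, v ≠ a → v ≠ b → (G.neighborSet v).ncard ≤ d := by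
    by_cases hex : ∃ b, b ≠ a ∧ d < (G.neighborSet b).ncard
    · obtain ⟨b, hba, hb⟩ := hex
      refine ⟨b, htwo a b ha hb hba.symm, fun v hva hvb => ?_⟩
      by_contra hv
      push Not at hv
      exact hfree a b v (htwo a b ha hb hba.symm) (htwo b v hb hv hvb.symm)
        (htwo a v ha hv hva.symm)
    · push Not at hex
      obtain ⟨b, hb⟩ := (Set.ncard_pos (Set.toFinite (G.neighborSet a))).mp (by omega)
      exact ⟨b, hb, fun v hva _ => hex v hva⟩
  have hend : ∀ u v, G.Adj u v → {w | G.Adj u w ∧ s(u, w) ≠ s(u, v)}.ncard ≤ d := by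
    intro u v huv
    have hsub : {w | G.Adj u w ∧ s(u, w) ≠ s(u, v)} ⊆ G.neighborSet u \ {v} := by
      rintro w ⟨hw, hne⟩
      exact ⟨hw, fun h => hne (by rw [Set.mem_singleton_iff.mp h])⟩
    have h1 := Set.ncard_le_ncard hsub (Set.toFinite _)
    have h2 := Set.ncard_sdiff_singleton_add_one (s := G.neighborSet u) (a := v) huv
      (Set.toFinite _)
    have h3 := hone u
    omega
  refine ⟨s(a, b), hab, fun v => ?_⟩
  by_cases hva : v = a
  · subst hva
    exact hend v b hab
  by_cases hvb : v = b
  · subst hvb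
    rw [Sym2.eq_swap]
    exact hend v a hab.symm
  · exact (Set.ncard_le_ncard (fun w hw => hw.1) (Set.toFinite _)).trans (hb v hva hvb)

variable {k}

/-- The dichotomy for primes containing `L_G(d)`: either the height is at least the number of edges,
or `e` has an end whose vector vanishes and which has `d` further neighbours with independent
vectors; in this case the height is one less. -/
theorem le_height_or_exists_independent [Fintype V] (hd : 3 ≤ d) (hconn : G.Connected)
    (huni : IsUnicyclic G) (hfree : ∀ u v w, G.Adj u v → G.Adj v w → ¬ G.Adj u w)
    {e : Sym2 V} (he : e ∈ G.edgeSet) (hdeg : ∀ v, {w | G.Adj v w ∧ s(v, w) ≠ e}.ncard ≤ d)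
    (P : Ideal (MvPolynomial (V × Fin d) k)) [P.IsPrime] (hP : lssIdeal k G d ≤ P) :
    (G.edgeSet.ncard : ℕ∞) ≤ P.height ∨ (G.edgeSet.ncard : ℕ∞) ≤ P.height + 1 ∧
      ∃ c ∈ e, ∃ W : Finset V, W.card = d ∧ (∀ w ∈ W, G.Adj c w ∧ s(c, w) ≠ e) ∧
        LinearIndependent P.ResidueField (fun w : W => genericVector P w) := by
  classical
  let T : Finset V := Finset.univ.filter fun v => genericVector P v = 0
  have hTm : ∀ v, v ∈ T ↔ genericVector P v = 0 := by simp [T]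
  have hTn : {v | genericVector P v = 0}.ncard = T.card := by
    rw [← Set.ncard_coe_finset]; congr 1; ext v; simp [T]
  have hTe : {e ∈ G.edgeSet | ∀ v ∈ e, genericVector P v ≠ 0} =
      {e ∈ G.edgeSet | ∀ v ∈ e, v ∉ T} := by simp only [hTm, Ne]
  have hS : ∀ c v, {w | G.Adj v w ∧ s(v, w) ≠ e ∧ (v = c → w ∉ T)}.ncard ≤ d := fun c v =>
    (Set.ncard_le_ncard (t := {w | G.Adj v w ∧ s(v, w) ≠ e}) (fun w hw => ⟨hw.1, hw.2.1⟩)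
      (Set.toFinite _)).trans (hdeg v)
  have hsum : ∀ c, ∑ v ∈ T, {w | G.Adj v w ∧ s(v, w) ≠ e ∧ (v = c → w ∉ T)}.ncard ≤ d * T.card := by
    intro c
    refine (Finset.sum_le_card_nsmul T _ d fun v _ => hS c v).trans ?_
    rw [smul_eq_mul, mul_comm]
  have hheight : ∀ c ∈ e, ∀ ε : ℕ, (ε = 0 ∨ ε = 1 ∧ c ∈ T ∧ ∃ W : Finset V, W.card ≤ d ∧
      (∀ w ∈ W, (G.Adj c w ∧ s(c, w) ≠ e) ∧ w ∉ T) ∧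
      ¬ LinearIndependent P.ResidueField (fun w : W => genericVector P w)) →
      ((d * T.card + {e ∈ G.edgeSet | ∀ v ∈ e, v ∉ T}.ncard + ε : ℕ) : ℕ∞) ≤ P.height := by
    intro c hc ε hε
    obtain ⟨H, a, b, hH, hHG, hGH, hcH⟩ := exists_spanning_tree hconn huni e c hc
    rw [← hTn, ← hTe]
    refine le_height_of_lssIdeal_le (c := c) hd hH hHG hGH hfree P hP ε (hε.imp_right ?_)
    rintro ⟨h1, h2, W, hWd, hW, hli⟩
    exact ⟨h1, (hTm c).mp h2, W, hWd, fun w hw => ⟨hcH w (hW w hw).1.1 (hW w hw).1.2,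
      fun h => (hW w hw).2 ((hTm w).mpr h)⟩, hli⟩
  obtain ⟨c₀, hc₀⟩ : ∃ c, c ∈ e := by
    induction e using Sym2.ind with
    | _ a b => exact ⟨a, by simp⟩
  have hbase := hheight c₀ hc₀ 0 (Or.inl rfl)
  by_cases heT : ∀ v ∈ e, v ∉ T
  · left
    refine le_trans (Nat.cast_le.mpr ?_) hbase
    have h1 := ncard_edgeSet_le G T e ∅ (Or.inl ⟨he, heT⟩) c₀
    have h2 := hsum c₀
    rw [Set.ncard_empty] at h1
    omega
  push Not at heT
  obtain ⟨c, hce, hcT⟩ := heT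
  have hcov := ncard_edgeSet_le G T e {e} (Or.inr rfl) c
  rw [Set.ncard_singleton] at hcov
  let S : Set V := {w | G.Adj c w ∧ s(c, w) ≠ e ∧ (c = c → w ∉ T)}
  let W : Finset V := S.toFinite.toFinset
  have hWm : ∀ w, w ∈ W ↔ (G.Adj c w ∧ s(c, w) ≠ e) ∧ w ∉ T := by simp [W, S, and_assoc]
  have hWS : W.card = S.ncard := (Set.ncard_eq_toFinset_card _ _).symm
  have hWd : W.card ≤ d := hWS.trans_le (hS c c)
  -- Now `e` meets `T` and costs one unit. It is regained if `c` has fewer than `d` counted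
  -- neighbours, or by `ε = 1` if their vectors are dependent.
  rcases hWd.lt_or_eq with hlt | heq
  · left
    refine le_trans (Nat.cast_le.mpr ?_) hbase
    have h1 : ∑ v ∈ T, {w | G.Adj v w ∧ s(v, w) ≠ e ∧ (v = c → w ∉ T)}.ncard < ∑ v ∈ T, d :=
      Finset.sum_lt_sum (fun v _ => hS c v) ⟨c, hcT, hWS ▸ hlt⟩
    rw [Finset.sum_const, smul_eq_mul, mul_comm] at h1
    omega
  by_cases hli : LinearIndependent P.ResidueField (fun w : W => genericVector P w)
  · right
    refine ⟨?_, c, hce, W, heq, fun w hw => ((hWm w).mp hw).1, hli⟩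
    refine le_trans ?_ (add_le_add_left hbase 1)
    have h2 := hsum c
    exact_mod_cast (by omega)
  · left
    refine le_trans (Nat.cast_le.mpr ?_)
      (hheight c hce 1 (Or.inr ⟨rfl, hcT, W, hWd, fun w hw => (hWm w).mp hw, hli⟩))
    have h2 := hsum c
    omega

theorem map_lssIdeal_eq_map_deleteEdges {e : Sym2 V} {c : V} (hc : c ∈ e)
    (P : Ideal (MvPolynomial (V × Fin d) k)) [P.IsPrime] (W : Finset V) (hW : W.card = d)
    (hadj : ∀ w ∈ W, G.Adj c w ∧ s(c, w) ≠ e)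
    (hli : LinearIndependent P.ResidueField (fun w : W => genericVector P w)) :
    (lssIdeal k G d).map (algebraMap (MvPolynomial (V × Fin d) k) (Localization.AtPrime P)) =
      (lssIdeal k (G.deleteEdges {e}) d).map
        (algebraMap (MvPolynomial (V × Fin d) k) (Localization.AtPrime P)) := by
  refine le_antisymm ?_ (Ideal.map_mono ?_)
  · rw [lssIdeal_eq_span k d G, Ideal.map_le_iff_le_comap, Ideal.span_le]
    rintro _ ⟨f, hf, rfl⟩
    by_cases hfe : f = e
    · subst hfe
      obtain ⟨c', rfl⟩ := hc
      exact lssPoly_mem_of_forall_X_mem _ _ (fun l => X_mem_map_lssIdeal P c W hW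
        (fun w hw => by simpa using hadj w hw) hli l) c'
    · exact Ideal.mem_map_of_mem _ (edgePoly_mem (by simp [hf, hfe]))
  · rw [lssIdeal_eq_span, Ideal.span_le]
    rintro _ ⟨f, hf, rfl⟩
    exact edgePoly_mem (by simp at hf; exact hf.1)

theorem isAlmostCompleteIntersection_of_edge [Fintype V] (hd : 3 ≤ d) (hconn : G.Connected)
    (huni : IsUnicyclic G) (hfree : ∀ u v w, G.Adj u v → G.Adj v w → ¬ G.Adj u w)
    (hmax : d < maxDeg G) {e : Sym2 V} (he : e ∈ G.edgeSet)
    (hdeg : ∀ v, {w | G.Adj v w ∧ s(v, w) ≠ e}.ncard ≤ d) :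
    IsAlmostCompleteIntersection (lssIdeal k G d) := by
  have hfg : ∀ G' : SimpleGraph V, Submodule.FG (lssIdeal k G' d) := fun G' =>
    IsNoetherian.noetherian _
  have hdich := fun (P : Ideal (MvPolynomial (V × Fin d) k)) (hp : P.IsPrime)
    (hP : lssIdeal k G d ≤ P) => le_height_or_exists_independent hd hconn huni hfree he hdeg P hP
  refine ⟨hfg G, ?_, fun P hp hP => isCompleteIntersection_map G P hP ?_⟩
  · rw [spanFinrank_lssIdeal k d (by omega)]
    refine le_antisymm ?_ ?_
    · have hpos : 0 < G.edgeSet.ncard := (Set.ncard_pos (Set.toFinite _)).mpr ⟨e, he⟩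
      obtain ⟨m, hm⟩ := Nat.exists_eq_add_of_lt hpos
      rw [zero_add] at hm
      rw [hm]
      push_cast
      refine add_le_add_left ?_ 1
      rw [Ideal.height_eq_inf_minimalPrimes]
      refine le_iInf₂ fun P hP => ?_
      have h1 : ((m + 1 : ℕ) : ℕ∞) ≤ P.height + 1 := by
        rw [← hm]
        rcases hdich P hP.1.1 hP.1.2 with h | h
        · exact h.trans le_self_add
        · exact h.1
      push_cast at h1
      exact (ENat.add_le_add_iff_right ENat.one_ne_top).mp h1
    -- Killing a vertex of degree above `d` removes more than `d` edges at the price of `d`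
    -- variables, so the height is strictly below the number of edges.
    · obtain ⟨a, ha⟩ : ∃ a, d < (G.neighborSet a).ncard := by
        by_contra hcon
        push Not at hcon
        exact absurd ((maxDeg_le_iff d).mpr hcon) (not_le.mpr hmax)
      refine (add_le_add_left (height_lssIdeal_le k d G {a}) 1).trans ?_
      have h1 := ncard_edges_add_ncard_neighborSet_le G a
      rw [Set.ncard_singleton]
      exact_mod_cast (by omega)
  · rcases hdich P hp hP.1.2 with h | ⟨h, c, hc, W, hW, hadj, hli⟩
    · refine le_trans (Nat.cast_le.mpr (Ideal.spanFinrank_map_le_of_fg _ (hfg G))) ?_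
      rwa [spanFinrank_lssIdeal k d (by omega)]
    · rw [map_lssIdeal_eq_map_deleteEdges hc P W hW hadj hli]
      refine le_trans (Nat.cast_le.mpr (Ideal.spanFinrank_map_le_of_fg _ (hfg _))) ?_
      rw [spanFinrank_lssIdeal k d (by omega)]
      rw [← ncard_edgeSet_deleteEdges he] at h
      push_cast at h
      exact (ENat.add_le_add_iff_right ENat.one_ne_top).mp h

end Criterion

end LSS

theorem mainTheorem4 (k : Type*) [Field k] (n d : ℕ) (hd : 3 ≤ d) (G : SimpleGraph (Fin n))
    (hconn : G.Connected) (huni : LSS.IsUnicyclic G)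
    (hC3 : (SimpleGraph.cycleGraph 3).Free G) (hdeg : d < LSS.maxDeg G) :
    LSS.IsAlmostCompleteIntersection (LSS.lssIdeal k G d) ↔
      (LSS.IsTreePlusEdge G d ∨ LSS.IsTreeUnicyclicPlusEdge G d) := by
  have hfree := LSS.not_adj_of_free_cycleGraph_three hC3
  constructor
  · intro h
    obtain ⟨e, he, hd'⟩ :=
      LSS.exists_edge_of_isAlmostCompleteIntersection k (by omega) hfree hdeg h
    exact LSS.isTreePlusEdge_or_of_edge hconn huni he hd'
  · intro h
    obtain ⟨e, he, hd'⟩ := h.elim LSS.exists_edge_of_isTreePlusEdge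
      LSS.exists_edge_of_isTreeUnicyclicPlusEdge
    exact LSS.isAlmostCompleteIntersection_of_edge hd hconn huni hfree hdeg he hd'
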